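/- Let $k$ be a field of characteristic $0$, let $\mathcal F = k\langle \mathbf c,\mathbf d\rangle$ with $\deg \mathbf c = 1$, $\deg \mathbf d = 2$, and let $\hat{\mathcal F} = k e \oplus \mathcal F$, where $e$ is a formal symbol of degree $-1$ and concatenation is extended by $e v = v e = 0$. The $\mathbf{cd}$-monomials ($e$ and all words in $\mathbf c,\mathbf d$, including the empty word $1$) form a basis of $\hat{\mathcal F}$; $v^*$ denotes the reversal of the monomial $v$, with $e^* = e$. For a graded poset $P$ of rank $n+1$ with least and greatest element and $S \subseteq [n]$, let $f_S$ be the number of chains of $P$ whose set of ranks is $S$, let $h_S = \sum_{T \subseteq S} (-1)^{|S \setminus T|} f_T$, and let the $\mathbf{ab}$-index of $P$ be $\sum_{S \subseteq [n]} h_S u_S$, where $u_S = u_1 \cdots u_n$ with $u_i = \mathbf b$ if $i \in S$ and $u_i = \mathbf a$ otherwise. The $\mathbf{cd}$-index of $P$ is the polynomial in $\mathbf c = \mathbf a + \mathbf b$ and $\mathbf d = \mathbf a \mathbf b + \mathbf b \mathbf a$ that equals the $\mathbf{ab}$-index. For a word $v$ of degree $n$ let $\beta(v)$ be the coefficient of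 $v$ in the $\mathbf{cd}$-index $\Psi(B_{n+1})$ of the Boolean lattice $B_{n+1}$ of all subsets of an $(n+1)$-element set; let $\beta(e) = 1$, and extend $\beta$ linearly to $\hat{\mathcal F}$. Let $\Delta : \mathcal F \to \mathcal F \otimes \mathcal F$ be the linear map with $\Delta(1) = 0$, $\Delta(\mathbf c) = 2 (1 \otimes 1)$, $\Delta(\mathbf d) = 1 \otimes \mathbf c + \mathbf c \otimes 1$ and $\Delta(uv) = \Delta(u) v + u \Delta(v)$. Define $\hat\Delta$ on $\hat{\mathcal F}$ by $\hat\Delta(e) = e \otimes e$ and $\hat\Delta(u) = \Delta(u) + e \otimes u + u \otimes e$ for $u \in \mathcal F$. Let $\odot$ be the product on $\hat{\mathcal F}$ dual to $\hat\Delta$: for monomials $u, v, w$, the coefficient of $w$ in $u \odot v$ is the coefficient of $u \otimes v$ in $\hat\Delta(w)$. Then the $\mathbf{cd}$-index of every $B_{n+1}$ ($n \ge 0$) exists and is unique, so that $\beta$ is well defined, and: (1) for all $\mathbf{cd}$-monomials $u$ and $v$, $\beta(u \odot v) = \beta(u \odot v^*) = \beta(u^* \odot v)$ and $\beta(u \odot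 v) = \beta(v \odot u)$; (2) for all $\mathbf{cd}$-monomials $u, v, w$, $$\beta(\mathbf d\, u\, \mathbf d \mathbf c \mathbf d\, v) = \beta(\mathbf d\, u^*\, \mathbf d \mathbf c \mathbf d\, v) \quad\text{and}\quad \beta(u\, \mathbf d \mathbf c \mathbf d\, v\, \mathbf d \mathbf c \mathbf d\, w) = \beta(u\, \mathbf d \mathbf c \mathbf d\, v^*\, \mathbf d \mathbf c \mathbf d\, w).$$ -/

import Mathlib

open scoped TensorProduct

noncomputable section

namespace CDIndex

/-! ## The ab-index and the cd-index of a graded poset -/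

/-- The two letters of the algebra `k⟨a, b⟩`. -/
inductive AB where
  | a
  | b
  deriving DecidableEq

/-- The two letters of the algebra `k⟨c, d⟩`. -/
inductive CD where
  | c
  | d
  deriving DecidableEq

section Poset

variable (P : Type*) [PartialOrder P] [BoundedOrder P] [Fintype P] [GradeMinOrder ℕ P]

open Classical in
/-- The flag `f`-vector: the number of chains of `P` whose elements occupy exactly the ranks in
`S`. The rank function of the graded poset `P` is `grade ℕ`. -/
def flagF (S : Finset ℕ) : ℕ :=
  (Finset.univ.filter fun C : Finset P =>
    IsChain (· ≤ ·) (C : Set P) ∧ C.image (grade ℕ) = S).card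

/-- The flag `h`-vector. -/
def flagH (S : Finset ℕ) : ℤ :=
  ∑ T ∈ S.powerset, (-1) ^ (S \ T).card * (flagF P T : ℤ)

/-- The monomial `u_S = u_1 u_2 ⋯ u_n` with `u_i = b` if `i ∈ S` and `u_i = a` otherwise. -/
def uMon (k : Type*) [Field k] (n : ℕ) (S : Finset ℕ) : FreeAlgebra k AB :=
  ((List.range n).map fun i => FreeAlgebra.ι k (if i + 1 ∈ S then AB.b else AB.a)).prod

/-- The **ab**-index `∑_{S ⊆ [n]} h_S u_S` of a graded poset `P` of rank `n + 1`. -/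
def abIndex (k : Type*) [Field k] : FreeAlgebra k AB :=
  ∑ S ∈ (Finset.Icc 1 (grade ℕ (⊤ : P) - 1)).powerset,
    (flagH P S : k) • uMon k (grade ℕ (⊤ : P) - 1) S

/-- The substitution `c ↦ a + b`, `d ↦ ab + ba`. -/
def cdToAB (k : Type*) [Field k] : FreeAlgebra k CD →ₐ[k] FreeAlgebra k AB :=
  FreeAlgebra.lift k fun x => match x with
    | CD.c => FreeAlgebra.ι k AB.a + FreeAlgebra.ι k AB.b
    | CD.d => FreeAlgebra.ι k AB.a * FreeAlgebra.ι k AB.b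
        + FreeAlgebra.ι k AB.b * FreeAlgebra.ι k AB.a

open Classical in
/-- The **cd**-index of `P`: the noncommutative polynomial in `c`, `d` that becomes the
**ab**-index of `P` under `c = a + b`, `d = ab + ba` (and `0` if there is no such polynomial). -/
def cdIndex (k : Type*) [Field k] : FreeAlgebra k CD :=
  if h : ∃ Φ : FreeAlgebra k CD, cdToAB k Φ = abIndex P k then h.choose else 0

end Poset

/-- The Boolean lattice of rank `n`: all subsets of an `n`-element set, ordered by inclusion. -/
abbrev Boolean (n : ℕ) : Type := Finset (Fin n)

/-! ## The extended space spanned by all **cd**-monomials -/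

/-- **cd**-monomials: the formal symbol `e` (`none`) and the words in `c`, `d` (`some w`). -/
abbrev Mon : Type := Option (FreeMonoid CD)

/-- The reverse of a **cd**-monomial; `e` is its own reverse. -/
def Mon.rev (v : Mon) : Mon := v.map FreeMonoid.reverse

/-- The degree of a letter: `c` has degree `1` and `d` has degree `2`. -/
def letterDeg : CD → ℕ
  | CD.c => 1
  | CD.d => 2

/-- The degree of a word in `c`, `d`. -/
def wordDeg (w : FreeMonoid CD) : ℕ := (w.toList.map letterDeg).sum

variable (k : Type*) [Field k]

/-- The vector space `k e ⊕ k⟨c, d⟩`, with its basis of **cd**-monomials. -/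
abbrev Fhat : Type _ := Mon →₀ k

/-- A **cd**-monomial as an element of `Fhat k`. -/
def mon (v : Mon) : Fhat k := Finsupp.single v 1

/-- The letter `c` as an element of `Fhat k`. -/
def cHat : Fhat k := mon k (some (FreeMonoid.of CD.c))

/-- The letter `d` as an element of `Fhat k`. -/
def dHat : Fhat k := mon k (some (FreeMonoid.of CD.d))

/-- Concatenation of two monomials, with the convention `e v = v e = 0`. -/
def concatMon : Mon → Mon → Fhat k
  | some u, some v => mon k (some (u * v))
  | _, _ => 0

/-- The concatenation product, extended bilinearly. -/
def concat : Fhat k →ₗ[k] Fhat k →ₗ[k] Fhat k :=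
  Finsupp.linearCombination k fun u => Finsupp.linearCombination k fun v => concatMon k u v

/-- The coproduct `Δ` on the letters: `Δ(c) = 2 (1 ⊗ 1)` and `Δ(d) = 1 ⊗ c + c ⊗ 1`. -/
def copLetter : CD → Fhat k ⊗[k] Fhat k
  | CD.c => (2 : k) • (mon k (some 1) ⊗ₜ mon k (some 1))
  | CD.d => mon k (some 1) ⊗ₜ cHat k + cHat k ⊗ₜ mon k (some 1)

/-- The coproduct `Δ` on words, by `Δ(1) = 0` and `Δ(x v) = Δ(x) v + x Δ(v)` for a letter `x`,
where words multiply the outer tensor factors by concatenation. -/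
def copWord : List CD → Fhat k ⊗[k] Fhat k
  | [] => 0
  | x :: l =>
    ((concat k).flip (mon k (some (FreeMonoid.ofList l)))).lTensor (Fhat k) (copLetter k x)
    + (concat k (mon k (some (FreeMonoid.of x)))).rTensor (Fhat k) (copWord l)

/-- The extended coproduct on monomials: `e ↦ e ⊗ e` and `u ↦ Δ(u) + e ⊗ u + u ⊗ e`. -/
def copMon : Mon → Fhat k ⊗[k] Fhat k
  | none => mon k none ⊗ₜ mon k none
  | some u => copWord k u.toList + mon k none ⊗ₜ mon k (some u) + mon k (some u) ⊗ₜ mon k none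

/-- The extended coproduct. -/
def cop : Fhat k →ₗ[k] Fhat k ⊗[k] Fhat k := Finsupp.linearCombination k (copMon k)

/-- The identification of `Fhat k` with its restricted dual that sends the monomial `v` to the
delta function `δ_v`. -/
def toDual (x : Fhat k) : Module.Dual k (Fhat k) := Finsupp.linearCombination k (x : Mon → k)

/-- The value of the convolution product of the functionals `x` and `y` at the monomial `w`. -/
def dotCoeff (x y : Fhat k) (w : Mon) : k :=
  TensorProduct.dualDistrib k (Fhat k) (Fhat k) (toDual k x ⊗ₜ toDual k y) (cop k (mon k w))

/-! The convolution product of two functionals of bounded degree has bounded degree. -/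

/-- The degree of a monomial, shifted by one so that `e` has value `0`. -/
def degSucc : Mon → ℕ
  | none => 0
  | some w => wordDeg w + 1

/-- The span of the tensors of total shifted degree `n`. -/
def tens (n : ℕ) : Submodule k (Fhat k ⊗[k] Fhat k) :=
  Submodule.span k {t | ∃ u v : Mon, degSucc u + degSucc v = n ∧ t = mon k u ⊗ₜ mon k v}

lemma wordDeg_mul (u v : FreeMonoid CD) : wordDeg (u * v) = wordDeg u + wordDeg v := by
  simp [wordDeg]

lemma mem_tens {n : ℕ} {u v : Mon} (h : degSucc u + degSucc v = n) :
    mon k u ⊗ₜ mon k v ∈ tens k n :=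
  Submodule.subset_span ⟨u, v, h, rfl⟩

lemma concat_mon (u v : Mon) : concat k (mon k u) (mon k v) = concatMon k u v := by
  simp [concat, mon]

lemma lTensor_mem {n : ℕ} (w : FreeMonoid CD) {t : Fhat k ⊗[k] Fhat k} (ht : t ∈ tens k n) :
    ((concat k).flip (mon k (some w))).lTensor (Fhat k) t ∈ tens k (n + wordDeg w) := by
  induction ht using Submodule.span_induction with
  | mem t ht =>
    obtain ⟨u, v, h, rfl⟩ := ht
    rw [LinearMap.lTensor_tmul, LinearMap.flip_apply, concat_mon]
    cases v with
    | none => simp [concatMon]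
    | some v =>
      apply mem_tens
      simp only [degSucc, wordDeg_mul] at h ⊢
      omega
  | zero => simp
  | add x y _ _ hx hy => rw [map_add]; exact add_mem hx hy
  | smul a x _ hx => rw [map_smul]; exact Submodule.smul_mem _ _ hx

lemma rTensor_mem {n : ℕ} (w : FreeMonoid CD) {t : Fhat k ⊗[k] Fhat k} (ht : t ∈ tens k n) :
    (concat k (mon k (some w))).rTensor (Fhat k) t ∈ tens k (n + wordDeg w) := by
  induction ht using Submodule.span_induction with
  | mem t ht =>
    obtain ⟨u, v, h, rfl⟩ := ht
    rw [LinearMap.rTensor_tmul, concat_mon]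
    cases u with
    | none => simp [concatMon]
    | some u =>
      apply mem_tens
      simp only [degSucc, wordDeg_mul] at h ⊢
      omega
  | zero => simp
  | add x y _ _ hx hy => rw [map_add]; exact add_mem hx hy
  | smul a x _ hx => rw [map_smul]; exact Submodule.smul_mem _ _ hx

lemma copWord_mem (l : List CD) : copWord k l ∈ tens k (wordDeg (FreeMonoid.ofList l) + 1) := by
  induction l with
  | nil => exact zero_mem _
  | cons x l ih =>
    have hl : wordDeg (FreeMonoid.ofList (x :: l))
        = letterDeg x + wordDeg (FreeMonoid.ofList l) := by simp [wordDeg]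
    have hx : copLetter k x ∈ tens k (letterDeg x + 1) := by
      cases x with
      | c =>
        refine Submodule.smul_mem _ _ (mem_tens k ?_)
        simp [degSucc, wordDeg, letterDeg]
      | d =>
        refine add_mem (mem_tens k ?_) (mem_tens k ?_) <;>
        simp [degSucc, wordDeg, letterDeg]
    rw [copWord, hl]
    refine add_mem ?_ ?_
    · have h := lTensor_mem k (FreeMonoid.ofList l) hx
      convert h using 2
      omega
    · have h := rTensor_mem k (FreeMonoid.of x) ih
      convert h using 2
      simp [wordDeg]
      omega

lemma copMon_mem (w : Mon) : copMon k w ∈ tens k (degSucc w) := by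
  cases w with
  | none => exact mem_tens k rfl
  | some w =>
    refine add_mem (add_mem (copWord_mem k _) (mem_tens k ?_)) (mem_tens k ?_) <;>
    simp [degSucc]

lemma finite_degSucc_le (n : ℕ) : {w : Mon | degSucc w ≤ n}.Finite := by
  have : Finite CD := Finite.of_injective (fun x : CD => decide (x = CD.c)) (by
    intro x y; cases x <;> cases y <;> simp)
  have h1 : {l : List CD | l.length ≤ n}.Finite := List.finite_length_le CD n
  refine ((h1.image fun l => some (FreeMonoid.ofList l)).insert none).subset ?_
  rintro (_ | w) hw
  · exact Set.mem_insert _ _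
  · refine Set.mem_insert_of_mem _ ⟨w.toList, ?_, by simp⟩
    have hlen : ∀ l : List CD, l.length ≤ (l.map letterDeg).sum := by
      intro l
      induction l with
      | nil => simp
      | cons x l ih => cases x <;> simp [letterDeg] <;> omega
    have := hlen w.toList
    simp only [Set.mem_ofPred_eq, degSucc, wordDeg] at hw ⊢
    omega

lemma dotCoeff_finite (x y : Fhat k) : (Function.support (dotCoeff k x y)).Finite := by
  refine (finite_degSucc_le (x.support.sup degSucc + y.support.sup degSucc)).subset ?_
  intro w hw
  by_contra hlt
  apply hw
  have key : ∀ t ∈ tens k (degSucc w), TensorProduct.dualDistrib k (Fhat k) (Fhat k)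
      (toDual k x ⊗ₜ toDual k y) t = 0 := by
    intro t ht
    induction ht using Submodule.span_induction with
    | mem t ht =>
      obtain ⟨u, v, h, rfl⟩ := ht
      simp only [TensorProduct.dualDistrib_apply, toDual, mon, Finsupp.linearCombination_single,
        one_smul]
      by_contra hne
      have hu := Finset.le_sup (f := degSucc) (Finsupp.mem_support_iff.2 (left_ne_zero_of_mul hne))
      have hv := Finset.le_sup (f := degSucc) (Finsupp.mem_support_iff.2 (right_ne_zero_of_mul hne))
      simp only [Set.mem_ofPred_eq] at hlt
      omega
    | zero => simp
    | add x y _ _ hx hy => rw [map_add, hx, hy, add_zero]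
    | smul a x _ hx => rw [map_smul, hx, smul_zero]
  have hc : cop k (mon k w) = copMon k w := by simp [cop, mon]
  unfold dotCoeff
  rw [hc]
  exact key _ (copMon_mem k w)

/-- The product `⊙` on `Fhat k` dual to the extended coproduct. -/
def dot {k : Type*} [Field k] (x y : Fhat k) : Fhat k :=
  Finsupp.ofSupportFinite (dotCoeff k x y) (dotCoeff_finite k x y)

/-! ## The numbers `β` -/

/-- For a word `v` of degree `n`, the coefficient of `v` in the **cd**-index of the Boolean
lattice of rank `n + 1`. The **cd**-index of the Boolean lattice of rank `0` is `e`, so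
`β(e) = 1`. -/
def betaMon : Mon → k
  | none => 1
  | some v =>
    (FreeAlgebra.equivMonoidAlgebraFreeMonoid (cdIndex (Boolean (wordDeg v + 1)) k)).coeff v

/-- The linear extension of `β` to `Fhat k`. -/
def beta : Fhat k →ₗ[k] k := Finsupp.linearCombination k (betaMon k)

/-- Concatenation, written as an infix operation. -/
def cat {k : Type*} [Field k] (x y : Fhat k) : Fhat k := concat k x y

scoped infixl:70 " ⋄ " => cat
scoped infixl:70 " ⊙ " => dot

end CDIndex

end

/-! Put `g(v) = β(v) / (deg v + 1)!` for words and `g(e) = 1`. Up to a factorial depending only on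
the total degree, `β(u ⊙ v)` equals `g(u) g(v)` (`beta_mon_dot_mon`), and `g` is invariant under
reversal (`IsRiccatiCoeff.reverse`). This gives the symmetries in (1). For (2), `ud ⊙ dv = 2 udcdv`,
because no `c` stands at the junction; hence `2 g(udcdv) = g(ud) g(dv)` (`normBeta_dcd`), which
isolates the factor `g(dud)` or `g(dvd)`, where reversal is harmless.

These properties of `g` come from a differential equation for `F = ∑ Ψ(B_n) x^n / n!`, summed over
`n ≥ 1`. Passing from flag `h` to flag `f` turns the letter `a` into `t = a - b`
(`sum_alternating_smul_uMon`). Splitting a chain of subsets at its greatest element gives `F = E + F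
b E` with `E = (exp(tx) - 1) / t` (`sum_chainsBelow_rankWord`). Differentiating, one obtains the
Riccati equation `F' = 1 + (cF + Fc)/2 + F d F/2` (`euler_chain_series`), in which only `c` and `d`
occur. Its unique solution over `k⟨c,d⟩` therefore maps to the **ab**-indices, so the **cd**-indices
exist; uniqueness is the injectivity of the substitution (`cdToAB_injective`).

Read on coefficients, the equation is a recursion for `g` (`IsRiccatiCoeff`) that is symmetric under
reversal and compatible with `⊙`. Induction on length then yields the multiplicativity
`IsRiccatiCoeff.dotEval_eq`. -/

open scoped TensorProduct

namespace CDIndex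

section BooleanChains

open PowerSeries Finset

/-! ### The noncommutative Riccati equation -/

section Riccati

variable (k : Type*) [Field k] {A B : Type*} [Ring A] [Algebra k A] [Ring B] [Algebra k B]

/-- The coefficients of a formal power series `f` with zero constant term that satisfies the
noncommutative Riccati equation `f' = 1 + (c f + f c) / 2 + f d f / 2`. -/
structure IsRiccati (c d : A) (x : ℕ → A) : Prop where
  zero : x 0 = 0
  succ : ∀ n, ((n + 1 : ℕ) : k) • x (n + 1) = (if n = 0 then 1 else 0)
    + (2⁻¹ : k) • (c * x n + x n * c)
    + (2⁻¹ : k) • ∑ p ∈ antidiagonal n, x p.1 * d * x p.2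

/-- The solution of the Riccati equation. -/
noncomputable def riccati (c d : A) : ℕ → A
  | 0 => 0
  | n + 1 => ((n + 1 : ℕ) : k)⁻¹ • ((if n = 0 then 1 else 0)
    + (2⁻¹ : k) • (c * riccati c d n + riccati c d n * c)
    + (2⁻¹ : k) • ∑ p ∈ (antidiagonal n).attach,
        riccati c d p.1.1 * d * riccati c d p.1.2)
  decreasing_by
    all_goals first
      | omega
      | (have := mem_antidiagonal.1 p.2; omega)

lemma isRiccati_riccati [CharZero k] (c d : A) : IsRiccati k c d (riccati k c d) where
  zero := by rw [riccati]
  succ n := by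
    rw [riccati, smul_smul, mul_inv_cancel₀ (by exact_mod_cast n.succ_ne_zero), one_smul,
      sum_attach (antidiagonal n) fun p => riccati k c d p.1 * d * riccati k c d p.2]

variable {k}

lemma IsRiccati.map {c d : A} {x : ℕ → A} (h : IsRiccati k c d x) (φ : A →ₐ[k] B) :
    IsRiccati k (φ c) (φ d) (fun n => φ (x n)) where
  zero := by rw [h.zero, map_zero]
  succ n := by
    rw [← map_smul, h.succ]
    simp [apply_ite φ]

/-- The equation determines `(n + 1) x (n + 1)` from earlier coefficients, and `n + 1` is
invertible. Solutions in different algebras are identified through this. -/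
lemma IsRiccati.unique [CharZero k] {c d : A} {x y : ℕ → A} (hx : IsRiccati k c d x)
    (hy : IsRiccati k c d y) : x = y := by
  funext n
  induction n using Nat.strong_induction_on with
  | _ n ih =>
    cases n with
    | zero => rw [hx.zero, hy.zero]
    | succ n =>
      have hn : ((n + 1 : ℕ) : k) ≠ 0 := by exact_mod_cast n.succ_ne_zero
      apply smul_right_injective A hn
      simp only
      rw [hx.succ, hy.succ, ih n n.lt_succ_self]
      congr 2
      refine sum_congr rfl fun p hp => ?_
      have := mem_antidiagonal.1 hp
      rw [ih p.1 (by omega), ih p.2 (by omega)]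

end Riccati

/-! ### The Euler operator on formal power series -/

section Euler

variable {A : Type*} [Ring A]

/-- The Euler operator `x d/dx` on formal power series. -/
noncomputable def euler (f : A⟦X⟧) : A⟦X⟧ := PowerSeries.mk fun n => n • coeff n f

lemma coeff_euler (f : A⟦X⟧) (n : ℕ) : coeff n (euler f) = n • coeff n f := by
  simp [euler]

lemma euler_add (f g : A⟦X⟧) : euler (f + g) = euler f + euler g := by
  ext n; simp [coeff_euler]

lemma euler_C (a : A) : euler (C a) = 0 := by
  ext n; rw [coeff_euler, coeff_C]; split_ifs with h <;> simp [h]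

lemma euler_mul (f g : A⟦X⟧) : euler (f * g) = euler f * g + f * euler g := by
  ext n
  rw [coeff_euler, map_add, coeff_mul, coeff_mul, coeff_mul, smul_sum, ← sum_add_distrib]
  refine sum_congr rfl fun p hp => ?_
  rw [coeff_euler, coeff_euler, ← mem_antidiagonal.1 hp, add_smul, smul_mul_assoc, mul_smul_comm]

/-- Multiplication by `g` raises the order, so each coefficient of `f` is built from lower ones,
which vanish. -/
lemma eq_zero_of_eq_mul {f g : A⟦X⟧} (hg : coeff 0 g = 0) (h : f = f * g) : f = 0 := by
  ext n
  induction n using Nat.strong_induction_on with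
  | _ n ih =>
    rw [h, coeff_mul, map_zero]
    refine sum_eq_zero fun p hp => ?_
    have := mem_antidiagonal.1 hp
    by_cases hp2 : p.2 = 0
    · rw [hp2, hg, mul_zero]
    · rw [ih p.1 (by omega), map_zero, zero_mul]

end Euler

/-! ### From the chain equation to the Riccati equation -/

section Exponential

variable (k : Type*) [Field k] {A : Type*} [Ring A] [Algebra k A]

/-- The series `(exp (t x) - 1) / t`. -/
noncomputable def expSeries (t : A) : A⟦X⟧ :=
  PowerSeries.mk fun n => if n = 0 then 0 else ((n.factorial : ℕ) : k)⁻¹ • t ^ (n - 1)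

lemma coeff_zero_expSeries (t : A) : coeff 0 (expSeries k t) = 0 := by simp [expSeries]

lemma coeff_succ_expSeries (t : A) (n : ℕ) :
    coeff (n + 1) (expSeries k t) = (((n + 1).factorial : ℕ) : k)⁻¹ • t ^ n := by
  simp [expSeries]

lemma expSeries_comm (t : A) : expSeries k t * C t = C t * expSeries k t := by
  ext n
  rw [coeff_mul_C, coeff_C_mul]
  cases n with
  | zero => simp [coeff_zero_expSeries]
  | succ n => rw [coeff_succ_expSeries, smul_mul_assoc, mul_smul_comm, pow_mul_comm']

lemma euler_expSeries [CharZero k] (t : A) :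
    euler (expSeries k t) = X * (1 + C t * expSeries k t) := by
  ext n
  rw [coeff_euler]
  cases n with
  | zero => simp
  | succ n =>
    rw [coeff_succ_X_mul, coeff_succ_expSeries, ← Nat.cast_smul_eq_nsmul k, smul_smul,
      map_add, coeff_C_mul, Nat.factorial_succ, Nat.cast_mul, mul_inv, ← mul_assoc,
      mul_inv_cancel₀ (by exact_mod_cast n.succ_ne_zero), one_mul]
    cases n with
    | zero => simp [coeff_zero_expSeries]
    | succ n =>
      rw [coeff_succ_expSeries, mul_smul_comm, pow_succ']
      simp [coeff_one]

variable {k}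

/-- Both equations describe `E (1 - bE)⁻¹ = (1 - Eb)⁻¹ E`. Inverses are avoided: the difference `D`
of the two sides satisfies `D = D b E`. -/
lemma chain_series_symm {F E : A⟦X⟧} {b : A} (hE : coeff 0 E = 0) (hF : F = E + F * C b * E) :
    F = E + E * C b * F := by
  rw [← sub_eq_zero]
  refine eq_zero_of_eq_mul (g := C b * E) (by simp [hE]) ?_
  have h1 : F * C b * E = F - E := by rw [eq_sub_iff_add_eq, add_comm, ← hF]
  have h2 : (F - (E + E * C b * F)) * (C b * E)
      = F * C b * E - E * C b * E - E * C b * (F * C b * E) := by noncomm_ring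
  rw [h2, h1]
  noncomm_ring

/-- With `t = a - b`, `E' = 1 + tE` gives `F' = (1 + Fb)(1 + tE)(1 + bF)`. The factor `E` can be
absorbed to the right, since `E(1 + bF) = F`, or to the left, since `(1 + Fb)E = F`. Neither form
alone is a polynomial in `F`, `a + b` and `ab + ba`, but their sum is. -/
lemma euler_chain_series [CharZero k] {F : A⟦X⟧} {a b : A}
    (hF : F = expSeries k (a - b) + F * C b * expSeries k (a - b)) :
    2 * euler F = X * (2 + (C (a + b) * F + F * C (a + b))
      + F * C (a * b + b * a) * F) := by
  have hF' := chain_series_symm (coeff_zero_expSeries k (a - b)) hF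
  have hE := euler_expSeries k (a - b)
  have hc := expSeries_comm k (a - b)
  generalize expSeries k (a - b) = E at *
  have hX : ∀ f : A⟦X⟧, X * f = f * X := fun f => X_mul
  have hG : (1 + F * C b) * E = F := by rw [add_mul, one_mul, ← hF]
  have hH : E * (1 + C b * F) = F := by
    rw [mul_add, mul_one, ← mul_assoc, ← hF']
  have h1 : (1 - C b * E) * (1 + C b * F) = 1 := by
    have : (1 - C b * E) * (1 + C b * F) = 1 + C b * (F - (E + E * C b * F)) := by noncomm_ring
    rw [this, ← hF', sub_self, mul_zero, add_zero]
  have h2 : euler F = euler E + (euler F * C b * E + F * C b * euler E) := by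
    conv_lhs => rw [hF]
    rw [euler_add, euler_mul, euler_mul, euler_C, mul_zero, add_zero]
  have h3 : euler F * (1 - C b * E) = (1 + F * C b) * euler E := by
    have h : euler F * (1 - C b * E) = euler F - euler F * C b * E := by noncomm_ring
    rw [h, sub_eq_iff_eq_add]
    conv_lhs => rw [h2]
    noncomm_ring
  have h4 : euler F = X * ((1 + F * C b) * (1 + C (a - b) * E) * (1 + C b * F)) := by
    calc euler F = euler F * ((1 - C b * E) * (1 + C b * F)) := by rw [h1, mul_one]
      _ = (1 + F * C b) * X * (1 + C (a - b) * E) * (1 + C b * F) := by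
        rw [← mul_assoc, h3, hE, ← mul_assoc]
      _ = _ := by rw [← hX, mul_assoc, mul_assoc, mul_assoc]
  have h5 : (1 + F * C b) * (1 + C (a - b) * E) * (1 + C b * F)
      = (1 + F * C b) * (1 + C b * F) + (1 + F * C b) * C (a - b) * F := by
    have : (1 + F * C b) * (1 + C (a - b) * E) * (1 + C b * F)
      = (1 + F * C b) * (1 + C b * F) + (1 + F * C b) * C (a - b) * (E * (1 + C b * F)) := by
      noncomm_ring
    rw [this, hH]
  -- Absorbing `E` to the left first requires moving it past `t`, with which it commutes.
  have h6 : (1 + F * C b) * (1 + C (a - b) * E) * (1 + C b * F)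
      = (1 + F * C b) * (1 + C b * F) + F * C (a - b) * (1 + C b * F) := by
    rw [← hc]
    have : (1 + F * C b) * (1 + E * C (a - b)) * (1 + C b * F)
      = (1 + F * C b) * (1 + C b * F) + ((1 + F * C b) * E) * C (a - b) * (1 + C b * F) := by
      noncomm_ring
    rw [this, hG]
  have h8 : 2 * euler F = X * (((1 + F * C b) * (1 + C b * F) + (1 + F * C b) * C (a - b) * F)
      + ((1 + F * C b) * (1 + C b * F) + F * C (a - b) * (1 + C b * F))) := by
    rw [mul_add, ← h5, ← h6, ← h4, two_mul]
  rw [h8]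
  simp only [map_sub, map_add, map_mul]
  noncomm_ring

lemma isRiccati_coeff [CharZero k] {F : A⟦X⟧} {a b : A}
    (hF : F = expSeries k (a - b) + F * C b * expSeries k (a - b)) :
    IsRiccati k (a + b) (a * b + b * a) (fun n => coeff n F) where
  zero := by
    have h : constantCoeff (expSeries k (a - b)) = 0 := by
      rw [← coeff_zero_eq_constantCoeff_apply, coeff_zero_expSeries]
    rw [hF]
    simp [h]
  succ n := by
    have h2 : (2 : k) ≠ 0 := two_ne_zero
    have h2' : ∀ x : A, (2⁻¹ : k) • (x + x) = x := fun x => by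
      rw [← two_smul k, smul_smul, inv_mul_cancel₀ h2, one_smul]
    have h := congrArg (fun f => (2⁻¹ : k) • coeff (n + 1) f) (euler_chain_series hF)
    simp only [coeff_succ_X_mul, two_mul, map_add (coeff _), coeff_euler, h2'] at h
    rw [Nat.cast_smul_eq_nsmul, h, coeff_C_mul, coeff_mul_C, coeff_mul n (F * _) F]
    simp only [coeff_mul_C, smul_add]
    congr 3
    have h3 : (2 : A⟦X⟧) = C (1 + 1) := by rw [map_add, map_one, one_add_one_eq_two]
    rw [h3, coeff_C]
    split_ifs
    · exact h2' 1
    · exact smul_zero _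

end Exponential

/-! ### Words recording rank sets -/

section Words

variable {A : Type*} [Ring A]

/-- The product `v_1 ⋯ v_n` with `v_i = b` if `i ∈ T` and `v_i = t` otherwise. -/
def rankWord (b t : A) (n : ℕ) (T : Finset ℕ) : A :=
  ((List.range n).map fun i => if i + 1 ∈ T then b else t).prod

lemma rankWord_succ (b t : A) (n : ℕ) (T : Finset ℕ) :
    rankWord b t (n + 1) T = rankWord b t n T * if n + 1 ∈ T then b else t := by
  simp [rankWord, List.range_succ]

lemma rankWord_congr (b t : A) {n : ℕ} {S T : Finset ℕ} (h : ∀ i, 1 ≤ i → i ≤ n → (i ∈ S ↔ i ∈ T)) :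
    rankWord b t n S = rankWord b t n T := by
  unfold rankWord
  congr 1
  refine List.map_congr_left fun i hi => ?_
  have := List.mem_range.1 hi
  simp only [h (i + 1) (by omega) (by omega)]

lemma rankWord_add (b t : A) (n m : ℕ) {T : Finset ℕ} (h : ∀ i ∈ T, i ≤ n) :
    rankWord b t (n + m) T = rankWord b t n T * t ^ m := by
  induction m with
  | zero => simp
  | succ m ih =>
    rw [← add_assoc, rankWord_succ, ih, if_neg fun hm => by have := h _ hm; omega, pow_succ,
      mul_assoc]

lemma rankWord_empty (b t : A) (n : ℕ) : rankWord b t n ∅ = t ^ n := by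
  simp [rankWord]

/-- Algebraic counterpart of removing the greatest element, of rank `n + 1`, from a chain. -/
lemma rankWord_insert (b t : A) {n : ℕ} {T : Finset ℕ} (h : ∀ i ∈ T, i ≤ n) (m : ℕ) :
    rankWord b t (n + 1 + m) (insert (n + 1) T) = rankWord b t n T * b * t ^ m := by
  rw [rankWord_add, rankWord_succ, if_pos (mem_insert_self _ _)]
  · congr 2
    refine rankWord_congr b t fun i _ hi => ?_
    rw [mem_insert, or_iff_right (by omega)]
  · intro i hi
    rcases mem_insert.1 hi with rfl | hi
    · rfl
    · have := h i hi
      omega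

end Words

/-! ### From the flag `h`-vector to the flag `f`-vector -/

section Inversion

variable (k : Type*) [Field k]

lemma uMon_succ (n : ℕ) (S : Finset ℕ) :
    uMon k (n + 1) S = uMon k n S * FreeAlgebra.ι k (if n + 1 ∈ S then AB.b else AB.a) := by
  simp [uMon, List.range_succ]

lemma uMon_insert (n : ℕ) (S : Finset ℕ) : uMon k n (insert (n + 1) S) = uMon k n S := by
  unfold uMon
  congr 1
  refine List.map_congr_left fun i hi => ?_
  have := List.mem_range.1 hi
  have h : i + 1 ∈ insert (n + 1) S ↔ i + 1 ∈ S := by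
    rw [mem_insert, or_iff_right (by omega)]
  simp only [h]

/-- Passing from the flag `h`-vector to the flag `f`-vector replaces `a` by `a - b`. -/
lemma sum_alternating_smul_uMon (n : ℕ) (f : Finset ℕ → k) :
    ∑ S ∈ (Icc 1 n).powerset, (∑ T ∈ S.powerset, (-1) ^ (S \ T).card * f T) • uMon k n S
      = ∑ T ∈ (Icc 1 n).powerset, f T • rankWord (FreeAlgebra.ι k AB.b)
          (FreeAlgebra.ι k AB.a - FreeAlgebra.ι k AB.b) n T := by
  induction n generalizing f with
  | zero => simp [uMon, rankWord]
  | succ n ih =>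
    have hI : Icc 1 (n + 1) = insert (n + 1) (Icc 1 n) := by
      ext i; simp only [mem_Icc, mem_insert]; omega
    have hn : n + 1 ∉ Icc 1 n := by simp
    have hS : ∀ S ∈ (Icc 1 n).powerset, n + 1 ∉ S := fun S hS h => hn (mem_powerset.1 hS h)
    rw [hI, sum_powerset_insert hn, sum_powerset_insert hn]
    have h1 : ∀ S ∈ (Icc 1 n).powerset,
        (∑ T ∈ S.powerset, (-1) ^ (S \ T).card * f T) • uMon k (n + 1) S
        = ((∑ T ∈ S.powerset, (-1) ^ (S \ T).card * f T) • uMon k n S)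
          * FreeAlgebra.ι k AB.a := fun S h => by
      rw [uMon_succ, if_neg (hS S h), smul_mul_assoc]
    -- Subsets of `S ∪ {n + 1}` that omit `n + 1` carry an extra sign. The resulting `-b` joins the
    -- `a` of `h1` to form the last letter `a - b`.
    have h2 : ∀ S ∈ (Icc 1 n).powerset,
        (∑ T ∈ (insert (n + 1) S).powerset, (-1) ^ (insert (n + 1) S \ T).card * f T)
          • uMon k (n + 1) (insert (n + 1) S)
        = ((∑ T ∈ S.powerset, (-1) ^ (S \ T).card * f (insert (n + 1) T)) • uMon k n S)
            * FreeAlgebra.ι k AB.b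
          - ((∑ T ∈ S.powerset, (-1) ^ (S \ T).card * f T) • uMon k n S)
            * FreeAlgebra.ι k AB.b := fun S h => by
      have e1 : ∀ T ∈ S.powerset,
          (-1) ^ (insert (n + 1) S \ insert (n + 1) T).card * f (insert (n + 1) T)
            = (-1) ^ (S \ T).card * f (insert (n + 1) T) := fun T _ => by
        rw [insert_sdiff_insert, sdiff_insert_of_notMem (hS S h)]
      have e2 : ∀ T ∈ S.powerset, (-1) ^ (insert (n + 1) S \ T).card * f T
            = -((-1) ^ (S \ T).card * f T) := fun T hT => by
        rw [insert_sdiff_of_notMem _ fun h' => hS S h (mem_powerset.1 hT h'),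
          card_insert_of_notMem fun h' => hS S h (mem_sdiff.1 h').1, pow_succ]
        ring
      rw [uMon_succ, uMon_insert, if_pos (mem_insert_self _ _), sum_powerset_insert (hS S h),
        sum_congr rfl e1, sum_congr rfl e2, ← smul_mul_assoc, ← sub_mul, ← sub_smul,
        sum_neg_distrib, neg_add_eq_sub]
    rw [sum_congr rfl h1, sum_congr rfl h2, sum_sub_distrib, ← sum_mul, ← sum_mul, ← sum_mul,
      ih f, ih fun T => f (insert (n + 1) T)]
    have h3 : ∀ T ∈ (Icc 1 n).powerset, f T • rankWord (FreeAlgebra.ι k AB.b)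
          (FreeAlgebra.ι k AB.a - FreeAlgebra.ι k AB.b) (n + 1) T
        = (f T • rankWord (FreeAlgebra.ι k AB.b) (FreeAlgebra.ι k AB.a - FreeAlgebra.ι k AB.b) n T)
          * (FreeAlgebra.ι k AB.a - FreeAlgebra.ι k AB.b) := fun T h => by
      rw [rankWord_succ, if_neg (hS T h), smul_mul_assoc]
    have h4 : ∀ T ∈ (Icc 1 n).powerset, f (insert (n + 1) T) • rankWord (FreeAlgebra.ι k AB.b)
          (FreeAlgebra.ι k AB.a - FreeAlgebra.ι k AB.b) (n + 1) (insert (n + 1) T)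
        = (f (insert (n + 1) T) •
            rankWord (FreeAlgebra.ι k AB.b) (FreeAlgebra.ι k AB.a - FreeAlgebra.ι k AB.b) n T)
          * FreeAlgebra.ι k AB.b := fun T h => by
      have := rankWord_insert (FreeAlgebra.ι k AB.b) (FreeAlgebra.ι k AB.a - FreeAlgebra.ι k AB.b)
        (n := n) (T := T) (fun i hi => (mem_Icc.1 (mem_powerset.1 h hi)).2) 0
      rw [add_zero, pow_zero, mul_one] at this
      rw [this, smul_mul_assoc]
    rw [sum_congr rfl h3, sum_congr rfl h4, ← sum_mul, ← sum_mul]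
    noncomm_ring

open Classical in
lemma abIndex_eq_sum_chains (P : Type*) [PartialOrder P] [BoundedOrder P] [Fintype P]
    [GradeMinOrder ℕ P] :
    abIndex P k = ∑ C ∈ univ.filter fun C : Finset P => IsChain (· ≤ ·) (C : Set P) ∧
        C.image (grade ℕ) ⊆ Icc 1 (grade ℕ (⊤ : P) - 1),
      rankWord (FreeAlgebra.ι k AB.b) (FreeAlgebra.ι k AB.a - FreeAlgebra.ι k AB.b)
        (grade ℕ (⊤ : P) - 1) (C.image (grade ℕ)) := by
  have h := sum_alternating_smul_uMon k (grade ℕ (⊤ : P) - 1) fun T => (flagF P T : k)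
  unfold abIndex flagH
  push_cast
  rw [h, ← sum_fiberwise_of_maps_to (t := (Icc 1 (grade ℕ (⊤ : P) - 1)).powerset)
    (g := fun C : Finset P => C.image (grade ℕ)) fun C hC =>
      mem_powerset.2 (mem_filter.1 hC).2.2]
  refine sum_congr rfl fun T hT => ?_
  rw [sum_congr rfl fun C hC => by rw [(mem_filter.1 hC).2], sum_const, filter_filter, flagF,
    Nat.cast_smul_eq_nsmul]
  congr 2
  ext C
  simp only [mem_filter, mem_univ, true_and]
  constructor
  · rintro ⟨h1, rfl⟩
    exact ⟨⟨h1, mem_powerset.1 hT⟩, rfl⟩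
  · rintro ⟨⟨h1, -⟩, h2⟩
    exact ⟨h1, h2⟩

end Inversion

/-! ### Chains of subsets, split at the greatest element -/

section Chains

lemma exists_greatest_of_isChain {α : Type*} {C : Finset (Finset α)}
    (h : IsChain (· ≤ ·) (C : Set (Finset α))) (hC : C.Nonempty) :
    ∃ m ∈ C, ∀ x ∈ C, x ≤ m := by
  obtain ⟨m, hm⟩ := C.exists_maximal hC
  refine ⟨m, hm.prop, fun x hx => ?_⟩
  rcases h.total hx hm.prop with h' | h'
  · exact h'
  · exact hm.le_of_ge hx h'

variable {α : Type*} [Fintype α] [DecidableEq α]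

open Classical in
/-- The chains of nonempty proper subsets of `s`. -/
noncomputable def chainsBelow (s : Finset α) : Finset (Finset (Finset α)) :=
  univ.filter fun C => IsChain (· ≤ ·) (C : Set (Finset α)) ∧ ∀ x ∈ C, x ≠ ∅ ∧ x ⊂ s

lemma mem_chainsBelow {s : Finset α} {C : Finset (Finset α)} :
    C ∈ chainsBelow s ↔
      IsChain (· ≤ ·) (C : Set (Finset α)) ∧ ∀ x ∈ C, x ≠ ∅ ∧ x ⊂ s := by
  simp [chainsBelow]

/-- A nonempty chain is determined by its greatest element and the chain below it. -/
lemma sum_chainsBelow {M : Type*} [AddCommMonoid M] (s : Finset α)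
    (g : Finset (Finset α) → M) :
    ∑ C ∈ chainsBelow s, g C = g ∅ + ∑ x ∈ s.powerset with x ≠ ∅ ∧ x ≠ s,
      ∑ C ∈ chainsBelow x, g (insert x C) := by
  have h0 : (∅ : Finset (Finset α)) ∈ chainsBelow s := by simp [mem_chainsBelow]
  rw [← add_sum_erase _ _ h0, sum_sigma']
  congr 1
  symm
  refine sum_bij (fun p _ => insert p.1 p.2) ?_ ?_ ?_ fun _ _ => rfl
  · rintro ⟨x, C⟩ h
    simp only [mem_sigma, mem_filter, mem_powerset, mem_chainsBelow] at h
    obtain ⟨⟨hxs, hx, hxs'⟩, hC, hCx⟩ := h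
    have hss : x ⊂ s := hxs.ssubset_of_ne hxs'
    rw [mem_erase, mem_chainsBelow]
    refine ⟨insert_ne_empty _ _, ?_, ?_⟩
    · rw [coe_insert]
      exact hC.insert fun y hy _ => Or.inr (hCx y hy).2.subset
    · intro y hy
      rcases mem_insert.1 hy with rfl | hy
      · exact ⟨hx, hss⟩
      · exact ⟨(hCx y hy).1, (hCx y hy).2.trans hss⟩
  · rintro ⟨x, C⟩ hx ⟨y, D⟩ hy h
    simp only [mem_sigma, mem_chainsBelow] at hx hy h
    have hxC : x ∉ C := fun h' => (hx.2.2 x h').2.ne rfl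
    have hyD : y ∉ D := fun h' => (hy.2.2 y h').2.ne rfl
    have hxy : x = y := by
      have h1 : x ∈ insert y D := h ▸ mem_insert_self x C
      have h2 : y ∈ insert x C := h.symm ▸ mem_insert_self y D
      rcases mem_insert.1 h1 with h1 | h1
      · exact h1
      · rcases mem_insert.1 h2 with h2 | h2
        · exact h2.symm
        · exact absurd ((hy.2.2 x h1).2.trans (hx.2.2 y h2).2) (ssubset_irrefl x)
    subst hxy
    have : C = D := by rw [← erase_insert hxC, h, erase_insert hyD]
    rw [this]
  · intro C hC
    rw [mem_erase, mem_chainsBelow] at hC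
    obtain ⟨hne, hC, hCs⟩ := hC
    obtain ⟨m, hm, hmax⟩ := exists_greatest_of_isChain hC (nonempty_iff_ne_empty.2 hne)
    refine ⟨⟨m, C.erase m⟩, ?_, insert_erase hm⟩
    simp only [mem_sigma, mem_filter, mem_powerset, mem_chainsBelow]
    refine ⟨⟨(hCs m hm).2.subset, (hCs m hm).1, (hCs m hm).2.ne⟩, ?_, ?_⟩
    · exact hC.mono (by simp)
    · intro x hx
      have hx' := mem_erase.1 hx
      exact ⟨(hCs x hx'.2).1, (hmax x hx'.2).ssubset_of_ne hx'.1⟩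

end Chains

/-! ### The chain series of the Boolean lattices -/

section ChainSeries

variable (k : Type*) [Field k] {A : Type*} [Ring A] [Algebra k A]

/-- The coefficients of the series `F` with `F = E + F b E`, where `E = (exp (t x) - 1) / t`. -/
noncomputable def chainCoeff (b t : A) (n : ℕ) : A :=
  coeff n (expSeries k t) + ∑ p ∈ (antidiagonal n).attach,
    if p.1.1 < n then chainCoeff b t p.1.1 * b * coeff p.1.2 (expSeries k t) else 0

/-- The guard in the definition only ensures termination: it drops the term with `p.2 = 0`, where
`E` has coefficient zero. -/
lemma chainCoeff_eq (b t : A) (n : ℕ) : chainCoeff k b t n = coeff n (expSeries k t)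
    + ∑ p ∈ antidiagonal n, chainCoeff k b t p.1 * b * coeff p.2 (expSeries k t) := by
  rw [chainCoeff, sum_attach (antidiagonal n) fun p =>
    if p.1 < n then chainCoeff k b t p.1 * b * coeff p.2 (expSeries k t) else 0]
  congr 1
  refine sum_congr rfl fun p hp => ?_
  have := mem_antidiagonal.1 hp
  split_ifs with h
  · rfl
  · have h2 : p.2 = 0 := by omega
    rw [h2, coeff_zero_expSeries, mul_zero]

lemma mk_chainCoeff (b t : A) : PowerSeries.mk (chainCoeff k b t)
    = expSeries k t + PowerSeries.mk (chainCoeff k b t) * C b * expSeries k t := by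
  ext n
  rw [map_add, coeff_mul, coeff_mk, chainCoeff_eq]
  simp only [coeff_mul_C, coeff_mk]

lemma isRiccati_chainCoeff [CharZero k] (a b : A) :
    IsRiccati k (a + b) (a * b + b * a) (chainCoeff k b (a - b)) := by
  have h := isRiccati_coeff (mk_chainCoeff k b (a - b))
  simpa using h

/-- Clearing factorials produces binomial coefficients, which will count the subsets of each size.
-/
lemma factorial_smul_chainCoeff [CharZero k] (b t : A) (n : ℕ) :
    n.factorial • chainCoeff k b t n = n.factorial • coeff n (expSeries k t)
      + ∑ i ∈ range (n + 1), n.choose i •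
        ((i.factorial • chainCoeff k b t i) * b *
          ((n - i).factorial • coeff (n - i) (expSeries k t))) := by
  rw [chainCoeff_eq, smul_add, Finset.Nat.sum_antidiagonal_eq_sum_range_succ_mk, smul_sum]
  congr 1
  refine sum_congr rfl fun i hi => ?_
  have hi' : i ≤ n := by have := mem_range.1 hi; omega
  rw [← Nat.choose_mul_factorial_mul_factorial hi', smul_mul_assoc, smul_mul_assoc,
    mul_smul_comm, mul_smul, mul_smul]

variable {α : Type*} [Fintype α] [DecidableEq α]

/-- A chain is empty, contributing `t ^ (|s| - 1)`, or has a greatest element `x`. Then its word is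
the word of the chain below `x`, followed by `b` and `t ^ (|s| - |x| - 1)`. Both powers of `t` are
coefficients of `E` times factorials, so grouping by `|x|` recovers the recursion. -/
lemma sum_chainsBelow_rankWord [CharZero k] (b t : A) (s : Finset α) (hs : s ≠ ∅) :
    ∑ C ∈ chainsBelow s, rankWord b t (s.card - 1) (C.image Finset.card)
      = s.card.factorial • chainCoeff k b t s.card := by
  induction s using Finset.strongInduction with
  | H s ih =>
    have hs0 : 0 < s.card := card_pos.2 (nonempty_iff_ne_empty.2 hs)
    have he : ∀ n, (n + 1).factorial • coeff (n + 1) (expSeries k t) = t ^ n := fun n => by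
      rw [coeff_succ_expSeries, ← Nat.cast_smul_eq_nsmul k, smul_smul, mul_inv_cancel₀
        (by exact_mod_cast (n + 1).factorial_ne_zero), one_smul]
    have h0 : chainCoeff k b t 0 = 0 := by
      rw [chainCoeff]; simp [coeff_zero_expSeries]
    rw [sum_chainsBelow, factorial_smul_chainCoeff, ← sum_powerset_apply_card (f := fun i =>
      (i.factorial • chainCoeff k b t i) * b *
          ((s.card - i).factorial • coeff (s.card - i) (expSeries k t))) (x := s), sum_filter]
    congr 1
    · rw [image_empty, rankWord_empty]
      conv_rhs => rw [← Nat.sub_add_cancel hs0]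
      rw [he]
    · refine sum_congr rfl fun x hx => ?_
      rw [mem_powerset] at hx
      split_ifs with h
      · have hxs : x ⊂ s := hx.ssubset_of_ne h.2
        have hlt := card_lt_card hxs
        have hx0 : 0 < x.card := card_pos.2 (nonempty_iff_ne_empty.2 h.1)
        rw [← ih x hxs h.1, sum_mul, sum_mul]
        refine sum_congr rfl fun C hC => ?_
        have hC' := (mem_chainsBelow.1 hC).2
        have e1 : s.card - x.card = (s.card - x.card - 1) + 1 := by omega
        have e2 : s.card - 1 = x.card - 1 + 1 + (s.card - x.card - 1) := by omega
        have e3 : x.card = x.card - 1 + 1 := by omega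
        rw [e1, he, image_insert, e2, ← rankWord_insert, ← e3]
        intro i hi
        obtain ⟨y, hy, rfl⟩ := mem_image.1 hi
        have := card_lt_card (hC' y hy).2
        omega
      -- The recursion also includes `x = ∅` and `x = s`; these terms vanish because neither series
      -- has a constant term.
      · rw [not_and_or, not_not, not_not] at h
        rcases h with rfl | rfl
        · simp [h0]
        · simp [coeff_zero_expSeries]

end ChainSeries

lemma abIndex_boolean (k : Type*) [Field k] [CharZero k] (n : ℕ) :
    abIndex (Boolean (n + 1)) k = (n + 1).factorial • chainCoeff k (FreeAlgebra.ι k AB.b)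
      (FreeAlgebra.ι k AB.a - FreeAlgebra.ι k AB.b) (n + 1) := by
  classical
  have h := sum_chainsBelow_rankWord k (FreeAlgebra.ι k AB.b)
    (FreeAlgebra.ι k AB.a - FreeAlgebra.ι k AB.b) (univ : Finset (Fin (n + 1))) univ_nonempty.ne_empty
  rw [card_univ, Fintype.card_fin] at h
  rw [← h, abIndex_eq_sum_chains]
  have hg : grade ℕ (⊤ : Boolean (n + 1)) = n + 1 := by simp
  rw [hg]
  have hgr : (grade ℕ : Boolean (n + 1) → ℕ) = Finset.card := rfl
  rw [hgr]
  refine sum_congr ?_ fun C _ => by congr!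
  ext C
  simp only [mem_filter, mem_univ, true_and, mem_chainsBelow]
  refine and_congr_right fun _ => ?_
  simp only [image_subset_iff, mem_Icc]
  refine forall₂_congr fun x _ => ?_
  rw [ssubset_univ_iff, Ne, ← card_eq_zero, Ne, ← card_eq_iff_eq_univ, Fintype.card_fin]
  have := card_le_univ x
  rw [Fintype.card_fin] at this
  omega

end BooleanChains

/-! ### Uniqueness of the **cd**-index -/

section Injectivity

variable (k : Type*) [Field k]

/-- A representation of `k⟨a, b⟩` by `2 × 2` matrices over `k⟨c, d⟩` in which `a + b` acts as `c`
and `a b + b a` acts as `d`. -/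
noncomputable def abMatrix : FreeAlgebra k AB →ₐ[k] Matrix (Fin 2) (Fin 2) (FreeAlgebra k CD) :=
  FreeAlgebra.lift k fun x =>
    let c := FreeAlgebra.ι k CD.c
    let t := c * c - (2 : k) • FreeAlgebra.ι k CD.d
    match x with
    | AB.a => (2⁻¹ : k) • !![c, t; 1, c]
    | AB.b => (2⁻¹ : k) • !![c, -t; -1, c]

/-- The matrices are `(c + M)/2` and `(c - M)/2` with `M² = c² - 2d`, so their sum is `c` and `ab +
ba` becomes `(c² - M²)/2 = d`. -/
lemma abMatrix_cdToAB [CharZero k] (Φ : FreeAlgebra k CD) :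
    abMatrix k (cdToAB k Φ) = Matrix.diagonal fun _ => Φ := by
  have h : (abMatrix k).comp (cdToAB k)
      = (Matrix.diagonalAlgHom k).comp (Pi.constAlgHom k (Fin 2) (FreeAlgebra k CD)) := by
    have h2 : (2 : k) ≠ 0 := two_ne_zero
    have h4 : ∀ x : FreeAlgebra k CD, (2⁻¹ : k) • x + (2⁻¹ : k) • x = x := fun x => by
      rw [← two_smul k, smul_smul, mul_inv_cancel₀ h2, one_smul]
    ext x i j
    cases x with
    | c => fin_cases i <;> fin_cases j <;> simp [abMatrix, cdToAB, h4, smul_sub]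
    | d =>
      fin_cases i <;> fin_cases j <;>
        simp [abMatrix, cdToAB, h4, smul_sub, smul_smul, mul_sub, sub_mul, mul_assoc]
  exact DFunLike.congr_fun h Φ

lemma cdToAB_injective [CharZero k] : Function.Injective (cdToAB k) := by
  intro Φ Ψ h
  have h' := congrArg (abMatrix k) h
  rw [abMatrix_cdToAB, abMatrix_cdToAB] at h'
  exact congrFun (Matrix.diagonal_injective h') 0

end Injectivity

/-! ### Existence of the **cd**-index of a Boolean lattice -/

section BooleanIndex

variable (k : Type*) [Field k] [CharZero k]

/-- The image of the solution over `k⟨c,d⟩` and the chain series solve the same Riccati equation, so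
they agree. -/
lemma cdToAB_riccati (n : ℕ) :
    cdToAB k ((n + 1).factorial • riccati k (FreeAlgebra.ι k CD.c) (FreeAlgebra.ι k CD.d) (n + 1))
      = abIndex (Boolean (n + 1)) k := by
  have h := (isRiccati_riccati k (FreeAlgebra.ι k CD.c) (FreeAlgebra.ι k CD.d)).map (cdToAB k)
  have hc : cdToAB k (FreeAlgebra.ι k CD.c) = FreeAlgebra.ι k AB.a + FreeAlgebra.ι k AB.b := by
    simp [cdToAB]
  have hd : cdToAB k (FreeAlgebra.ι k CD.d) = FreeAlgebra.ι k AB.a * FreeAlgebra.ι k AB.b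
      + FreeAlgebra.ι k AB.b * FreeAlgebra.ι k AB.a := by
    simp [cdToAB]
  rw [hc, hd] at h
  rw [map_nsmul, abIndex_boolean,
    congrFun (h.unique (isRiccati_chainCoeff k (FreeAlgebra.ι k AB.a) (FreeAlgebra.ι k AB.b)))]

lemma existsUnique_cdToAB_boolean (n : ℕ) :
    ∃! Φ : FreeAlgebra k CD, cdToAB k Φ = abIndex (Boolean (n + 1)) k :=
  ⟨_, cdToAB_riccati k n, fun _ h => cdToAB_injective k (h.trans (cdToAB_riccati k n).symm)⟩

lemma cdIndex_boolean (n : ℕ) : cdIndex (Boolean (n + 1)) k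
    = (n + 1).factorial • riccati k (FreeAlgebra.ι k CD.c) (FreeAlgebra.ι k CD.d) (n + 1) := by
  have h : ∃ Φ : FreeAlgebra k CD, cdToAB k Φ = abIndex (Boolean (n + 1)) k :=
    ⟨_, cdToAB_riccati k n⟩
  rw [cdIndex, dif_pos h]
  exact cdToAB_injective k (h.choose_spec.trans (cdToAB_riccati k n).symm)

end BooleanIndex

/-! ### Functionals on words and the multiplicativity of the Riccati coefficients -/

section Lists

variable {M : Type*} [Zero M]

/-- The functional `w ↦ g w'` if `w = c w'`, and `0` if `w` does not start with `c`. -/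
def headC (g : List CD → M) : List CD → M
  | CD.c :: l => g l
  | _ => 0

/-- The functional `w ↦ g w'` if `w = w' c`, and `0` if `w` does not end with `c`. -/
def lastC (g : List CD → M) (l : List CD) : M := headC (fun l' => g l'.reverse) l.reverse

@[simp] lemma headC_nil (g : List CD → M) : headC g [] = 0 := rfl
@[simp] lemma headC_c (g : List CD → M) (l : List CD) : headC g (CD.c :: l) = g l := rfl
@[simp] lemma headC_d (g : List CD → M) (l : List CD) : headC g (CD.d :: l) = 0 := rfl

@[simp] lemma headC_zero (l : List CD) : headC (fun _ => (0 : M)) l = 0 := by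
  rcases l with _ | ⟨_ | _, l⟩ <;> simp

@[simp] lemma lastC_nil (g : List CD → M) : lastC g [] = 0 := rfl
@[simp] lemma lastC_concat_c (g : List CD → M) (l : List CD) : lastC g (l ++ [CD.c]) = g l := by
  simp [lastC]
@[simp] lemma lastC_concat_d (g : List CD → M) (l : List CD) : lastC g (l ++ [CD.d]) = 0 := by
  simp [lastC]
@[simp] lemma lastC_cons_concat_c (g : List CD → M) (x : CD) (l : List CD) :
    lastC g (x :: (l ++ [CD.c])) = g (x :: l) := lastC_concat_c g (x :: l)
@[simp] lemma lastC_cons_concat_d (g : List CD → M) (x : CD) (l : List CD) :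
    lastC g (x :: (l ++ [CD.d])) = 0 := lastC_concat_d g (x :: l)
@[simp] lemma lastC_zero (l : List CD) : lastC (fun _ => (0 : M)) l = 0 := by
  simp [lastC]

@[simp] lemma lastC_single_c (g : List CD → M) : lastC g [CD.c] = g [] := lastC_concat_c g []
@[simp] lemma lastC_single_d (g : List CD → M) : lastC g [CD.d] = 0 := lastC_concat_d g []

lemma headC_apply {N : Type*} [Zero N] (φ : M → N) (hφ : φ 0 = 0) (g : List CD → M) (l : List CD) :
    φ (headC g l) = headC (fun l' => φ (g l')) l := by
  rcases l with _ | ⟨_ | _, l⟩ <;> simp [hφ]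

lemma lastC_apply {N : Type*} [Zero N] (φ : M → N) (hφ : φ 0 = 0) (g : List CD → M) (l : List CD) :
    φ (lastC g l) = lastC (fun l' => φ (g l')) l := headC_apply φ hφ _ _

variable {k : Type*} [Field k]

/-- The sum of `f u v` over all factorizations `w = u d v`. -/
def splitD (f : List CD → List CD → k) : List CD → k
  | [] => 0
  | CD.c :: l => splitD (fun u v => f (CD.c :: u) v) l
  | CD.d :: l => f [] l + splitD (fun u v => f (CD.d :: u) v) l

lemma list_concat_cases {motive : List CD → Prop} (nil : motive [])
    (concat_c : ∀ l, motive (l ++ [CD.c])) (concat_d : ∀ l, motive (l ++ [CD.d])) (l : List CD) :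
    motive l := by
  rcases List.eq_nil_or_concat' l with rfl | ⟨l, x, rfl⟩
  · exact nil
  · cases x
    · exact concat_c l
    · exact concat_d l

lemma splitD_add (f g : List CD → List CD → k) (l : List CD) :
    splitD (fun u v => f u v + g u v) l = splitD f l + splitD g l := by
  induction l generalizing f g with
  | nil => simp [splitD]
  | cons x l ih =>
    cases x
    · simp only [splitD, ih]
    · simp only [splitD, ih]
      ring

lemma splitD_mul_left (r : k) (f : List CD → List CD → k) (l : List CD) :
    splitD (fun u v => r * f u v) l = r * splitD f l := by
  induction l generalizing f with
  | nil => simp [splitD]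
  | cons x l ih => cases x <;> simp only [splitD, ih, mul_add]

lemma splitD_zero (l : List CD) : splitD (fun _ _ => (0 : k)) l = 0 := by
  simpa using splitD_mul_left (0 : k) (fun _ _ => 0) l

lemma splitD_sum {ι : Type*} (s : Finset ι) (f : ι → List CD → List CD → k) (l : List CD) :
    splitD (fun u v => ∑ i ∈ s, f i u v) l = ∑ i ∈ s, splitD (f i) l := by
  classical
  induction s using Finset.induction_on with
  | empty => simpa using splitD_zero l
  | insert i s hi ih => simp only [Finset.sum_insert hi, splitD_add, ih]

lemma splitD_congr {f g : List CD → List CD → k} {l : List CD}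
    (h : ∀ u v, u ++ CD.d :: v = l → f u v = g u v) : splitD f l = splitD g l := by
  induction l generalizing f g with
  | nil => rfl
  | cons x l ih =>
    cases x
    · exact ih fun u v huv => h _ v (by rw [← huv]; rfl)
    · rw [splitD, splitD, h [] l rfl, ih fun u v huv => h _ v (by rw [← huv]; rfl)]

lemma splitD_append (f : List CD → List CD → k) (l m : List CD) :
    splitD f (l ++ m) = splitD (fun u v => f u (v ++ m)) l + splitD (fun u v => f (l ++ u) v) m := by
  induction l generalizing f with
  | nil => simp [splitD]
  | cons x l ih =>
    cases x
    · simp only [List.cons_append, splitD, ih]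
    · simp only [List.cons_append, splitD, ih, add_assoc]

lemma splitD_reverse (f : List CD → List CD → k) (l : List CD) :
    splitD f l.reverse = splitD (fun u v => f v.reverse u.reverse) l := by
  induction l generalizing f with
  | nil => rfl
  | cons x l ih =>
    rw [List.reverse_cons, splitD_append, ih]
    cases x <;> simp [splitD, add_comm]

/-- The value of `g` at the convolution product of two words `u` and `v`. -/
def dotEval (g : List CD → k) (u v : List CD) : k :=
  2 * g (u ++ CD.c :: v) + headC (fun v' => g (u ++ CD.d :: v')) v
    + lastC (fun u' => g (u' ++ CD.d :: v)) u

/-- A leading `c` of a word in `u ⊙ v` is inherited from `u`, unless `u` is empty; then it is the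
inserted `c`, of weight 2. -/
lemma dotEval_headC (g : List CD → k) (u v : List CD) : dotEval (headC g) u v
    = headC (fun u' => dotEval g u' v) u + if u = [] then 2 * g v else 0 := by
  rcases u with _ | ⟨_ | _, u⟩
  · simp [dotEval]
  · induction u using list_concat_cases <;> simp [dotEval]
  · induction u using list_concat_cases <;> simp [dotEval]

lemma dotEval_reverse (g : List CD → k) (u v : List CD) :
    dotEval (fun l => g l.reverse) u v = dotEval g v.reverse u.reverse := by
  simp [dotEval, lastC]
  ring

lemma dotEval_lastC (g : List CD → k) (u v : List CD) : dotEval (lastC g) u v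
    = lastC (fun v' => dotEval g u v') v + if v = [] then 2 * g u else 0 := by
  refine (dotEval_reverse (headC fun l => g l.reverse) u v).trans ?_
  rw [dotEval_headC]
  simp only [dotEval_reverse, List.reverse_reverse, List.reverse_eq_nil_iff]
  rfl

/-- A `d` in a word of `u ⊙ v` lies in `u`, lies in `v`, or is the new `d` that replaces a `c` at
the head of `v` or at the end of `u`. These cases give the four terms. -/
lemma dotEval_splitD (f : List CD → List CD → k) (u v : List CD) : dotEval (splitD f) u v
    = splitD (fun x y => dotEval (f x) y v) u + splitD (fun x y => dotEval (fun z => f z y) u x) v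
      + headC (fun v' => f u v') v + lastC (fun u' => f u' v) u := by
  rcases v with _ | ⟨_ | _, v⟩ <;> induction u using list_concat_cases <;>
    simp only [dotEval, splitD_append, splitD_add, splitD_mul_left, splitD_zero, splitD, headC_nil,
      headC_c, headC_d, lastC_nil, lastC_concat_c, lastC_concat_d, List.append_assoc,
      List.nil_append, List.append_nil, List.cons_append] <;> ring

/-- The degree of a word given as a list of letters. -/
def listDeg (l : List CD) : ℕ := (l.map letterDeg).sum

@[simp] lemma listDeg_nil : listDeg [] = 0 := rfl
@[simp] lemma listDeg_cons (x : CD) (l : List CD) :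
    listDeg (x :: l) = letterDeg x + listDeg l := by simp [listDeg]
@[simp] lemma listDeg_append (u v : List CD) : listDeg (u ++ v) = listDeg u + listDeg v := by
  simp [listDeg]
@[simp] lemma listDeg_reverse (l : List CD) : listDeg l.reverse = listDeg l := by
  simp [listDeg, List.sum_reverse]

lemma listDeg_eq_zero {l : List CD} : listDeg l = 0 ↔ l = [] := by
  rcases l with _ | ⟨_ | _, l⟩ <;> simp [letterDeg]

/-- All words in `u ⊙ v` have the same degree, so a weight depending on the degree factors out. -/
lemma dotEval_listDeg_mul (φ : ℕ → k) (g : List CD → k) (u v : List CD) :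
    dotEval (fun l => φ (listDeg l) * g l) u v
      = φ (listDeg u + listDeg v + 1) * dotEval g u v := by
  have e1 : ∀ v, φ (listDeg (u ++ CD.c :: v)) = φ (listDeg u + listDeg v + 1) := fun v => by
    simp only [listDeg_append, listDeg_cons, letterDeg]
    congr 1
    omega
  simp only [dotEval, e1]
  rcases v with _ | ⟨_ | _, v⟩ <;> induction u using list_concat_cases <;>
    simp only [letterDeg, listDeg_append, listDeg_cons, listDeg_nil, headC_nil, headC_c,
      headC_d, lastC_nil, lastC_concat_c, lastC_concat_d] <;> ring_nf

/-- The recursion for the coefficients of the solution of the Riccati equation in `k⟨c, d⟩`. -/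
def IsRiccatiCoeff (g : List CD → k) : Prop :=
  ∀ l, ((listDeg l + 1 : ℕ) : k) * g l = (if l = [] then 1 else 0)
    + 2⁻¹ * (headC g l + lastC g l) + 2⁻¹ * splitD (fun u v => g u * g v) l

lemma dotEval_add (g h : List CD → k) (u v : List CD) :
    dotEval (fun l => g l + h l) u v = dotEval g u v + dotEval h u v := by
  rcases v with _ | ⟨_ | _, v⟩ <;> induction u using list_concat_cases <;>
    simp [dotEval] <;> ring

lemma dotEval_mul_left (r : k) (g : List CD → k) (u v : List CD) :
    dotEval (fun l => r * g l) u v = r * dotEval g u v := by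
  rcases v with _ | ⟨_ | _, v⟩ <;> induction u using list_concat_cases <;>
    simp [dotEval] <;> ring

lemma headC_congr {g h : List CD → k} {l : List CD} (H : ∀ l', l'.length < l.length → g l' = h l') :
    headC g l = headC h l := by
  rcases l with _ | ⟨_ | _, l⟩
  · rfl
  · exact H l (by simp)
  · rfl

lemma lastC_congr {g h : List CD → k} {l : List CD} (H : ∀ l', l'.length < l.length → g l' = h l') :
    lastC g l = lastC h l := headC_congr fun l' hl' => H _ (by simpa using hl')

lemma headC_mul_right (g : List CD → k) (r : k) (l : List CD) :
    headC (fun l' => g l' * r) l = headC g l * r := by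
  rcases l with _ | ⟨_ | _, l⟩ <;> simp

lemma lastC_mul_right (g : List CD → k) (r : k) (l : List CD) :
    lastC (fun l' => g l' * r) l = lastC g l * r := headC_mul_right _ r _

variable [CharZero k] {g : List CD → k}

/-- Reversal exchanges the `headC` and `lastC` terms and swaps the two commuting factors under
`splitD`, so the recursion is preserved. -/
lemma IsRiccatiCoeff.reverse (hg : IsRiccatiCoeff g) (l : List CD) : g l.reverse = g l := by
  induction hn : l.length using Nat.strong_induction_on generalizing l with
  | _ n ih =>
    subst hn
    have h0 : ((listDeg l + 1 : ℕ) : k) ≠ 0 := by exact_mod_cast (listDeg l).succ_ne_zero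
    apply mul_left_cancel₀ h0
    have h1 := hg l.reverse
    rw [listDeg_reverse] at h1
    rw [h1, hg l, splitD_reverse]
    have e1 : headC g l.reverse = lastC g l :=
      headC_congr fun l' hl' => (ih _ (by simpa using hl') l' rfl).symm
    have e2 : lastC g l.reverse = headC g l := by
      rw [lastC, List.reverse_reverse]
      exact headC_congr fun l' hl' => ih _ hl' l' rfl
    have e3 : splitD (fun u v => g v.reverse * g u.reverse) l = splitD (fun u v => g u * g v) l := by
      refine splitD_congr fun u v huv => ?_
      have : l.length = u.length + (v.length + 1) := by rw [← huv]; simp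
      rw [ih _ (by omega) u rfl, ih _ (by omega) v rfl, mul_comm]
    rw [e1, e2, e3, add_comm (lastC g l)]
    simp

/-- Apply the recursion inside `dotEval` and use induction on shorter pairs. The linear terms yield
only `headC` on `u` and `lastC` on `v`; the missing `headC` on `v` and `lastC` on `u` are the terms
of `dotEval_splitD` from a new `d`. The inserted `c`, of weight 2, supplies the inhomogeneous term
1. In total this is the recursion for `g u` times `g v` plus the recursion for `g v` times `g u`. -/
lemma IsRiccatiCoeff.dotEval_eq (hg : IsRiccatiCoeff g) (u v : List CD) :
    dotEval g u v = g u * g v := by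
  induction hn : u.length + v.length using Nat.strong_induction_on generalizing u v with
  | _ n ih =>
    subst hn
    have h0 : ((listDeg u + listDeg v + 1 + 1 : ℕ) : k) ≠ 0 := by
      exact_mod_cast (listDeg u + listDeg v + 1).succ_ne_zero
    apply mul_left_cancel₀ h0
    have h2 : (2 : k) ≠ 0 := two_ne_zero
    rw [← dotEval_listDeg_mul fun n => ((n + 1 : ℕ) : k), funext hg, dotEval_add, dotEval_add, dotEval_mul_left,
      dotEval_mul_left, dotEval_add, dotEval_headC, dotEval_lastC, dotEval_splitD]
    have e0 : dotEval (fun l => if l = [] then (1 : k) else 0) u v = 0 := by simp [dotEval]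
    have e1 : headC (fun u' => dotEval g u' v) u = headC g u * g v := by
      rw [← headC_mul_right]
      exact headC_congr fun l hl => ih _ (by omega) l v rfl
    have e2 : lastC (fun v' => dotEval g u v') v = lastC g v * g u := by
      rw [← lastC_mul_right]
      exact lastC_congr fun l hl => by rw [ih _ (by omega) u l rfl, mul_comm]
    have e3 : splitD (fun x y => dotEval (fun z => g x * g z) y v) u
        = g v * splitD (fun x y => g x * g y) u := by
      rw [← splitD_mul_left]
      refine splitD_congr fun x y hxy => ?_
      have : u.length = x.length + (y.length + 1) := by rw [← hxy]; simp
      rw [dotEval_mul_left, ih _ (by omega) y v rfl]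
      ring
    have e4 : splitD (fun x y => dotEval (fun z => g z * g y) u x) v
        = g u * splitD (fun x y => g x * g y) v := by
      rw [← splitD_mul_left]
      refine splitD_congr fun x y hxy => ?_
      have : v.length = x.length + (y.length + 1) := by rw [← hxy]; simp
      simp only [mul_comm _ (g y)]
      rw [dotEval_mul_left, ih _ (by omega) u x rfl]
      ring
    have e5 : headC (fun v' => g u * g v') v = headC g v * g u := by
      rw [← headC_mul_right]; simp only [mul_comm]
    have e6 : lastC (fun u' => g u' * g v) u = lastC g u * g v := lastC_mul_right _ _ _
    rw [e0, e1, e2, e3, e4, e5, e6]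
    have e7 : (if u = [] then 2 * g v else 0) = 2 * ((if u = [] then 1 else 0) * g v) := by
      split_ifs <;> simp
    have e8 : (if v = [] then 2 * g u else 0) = 2 * ((if v = [] then 1 else 0) * g u) := by
      split_ifs <;> simp
    rw [e7, e8]
    -- The weight splits as `(deg u + 1) + (deg v + 1)`, one summand for each recursion.
    have : ((listDeg u + listDeg v + 1 + 1 : ℕ) : k) * (g u * g v)
      = ((listDeg u + 1 : ℕ) : k) * g u * g v + ((listDeg v + 1 : ℕ) : k) * g v * g u := by
      push_cast
      ring
    rw [this, hg u, hg v]
    field_simp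
    ring

end Lists

/-! ### Coefficients of the solution in `k⟨c,d⟩` -/

section Coefficients

variable {k : Type*} [Field k]

/-- The coefficient of a word in an element of the monoid algebra of the free monoid. -/
def wordCoeff (x : MonoidAlgebra k (FreeMonoid CD)) (l : List CD) : k :=
  x.coeff (FreeMonoid.ofList l)

@[simp] lemma wordCoeff_add (x y : MonoidAlgebra k (FreeMonoid CD)) (l : List CD) :
    wordCoeff (x + y) l = wordCoeff x l + wordCoeff y l := rfl

@[simp] lemma wordCoeff_smul (r : k) (x : MonoidAlgebra k (FreeMonoid CD)) (l : List CD) :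
    wordCoeff (r • x) l = r * wordCoeff x l := rfl

@[simp] lemma wordCoeff_zero (l : List CD) :
    wordCoeff (0 : MonoidAlgebra k (FreeMonoid CD)) l = 0 := rfl

lemma wordCoeff_sum {ι : Type*} (s : Finset ι) (x : ι → MonoidAlgebra k (FreeMonoid CD))
    (l : List CD) : wordCoeff (∑ i ∈ s, x i) l = ∑ i ∈ s, wordCoeff (x i) l := by
  simp [wordCoeff, MonoidAlgebra.coeff_sum]

lemma wordCoeff_one (l : List CD) :
    wordCoeff (1 : MonoidAlgebra k (FreeMonoid CD)) l = if l = [] then 1 else 0 := by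
  classical
  rw [wordCoeff, MonoidAlgebra.one_def, MonoidAlgebra.coeff_single, Finsupp.single_apply]
  exact if_congr ⟨fun h => h.symm, fun h => h.symm⟩ rfl rfl

lemma wordCoeff_letter_mul_nil (x : CD) (r : k) (y : MonoidAlgebra k (FreeMonoid CD)) :
    wordCoeff (.single (.of x) r * y) [] = 0 :=
  MonoidAlgebra.coeff_single_mul_of_forall_mul_ne r y fun w h => by
    have := congrArg FreeMonoid.length h
    simp at this

lemma wordCoeff_letter_mul_cons (x z : CD) (r : k) (y : MonoidAlgebra k (FreeMonoid CD))
    (l : List CD) :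
    wordCoeff (.single (.of x) r * y) (z :: l) = if z = x then r * wordCoeff y l else 0 := by
  split_ifs with h
  · subst h
    exact MonoidAlgebra.coeff_single_mul_eq_mul_coeff _ fun w _ =>
      ⟨fun h => List.tail_eq_of_cons_eq h, fun h => by rw [h]; rfl⟩
  · exact MonoidAlgebra.coeff_single_mul_of_forall_mul_ne r y fun w hw =>
      h (List.head_eq_of_cons_eq hw).symm

lemma wordCoeff_mul_letter_nil (x : CD) (r : k) (y : MonoidAlgebra k (FreeMonoid CD)) :
    wordCoeff (y * .single (.of x) r) [] = 0 :=
  MonoidAlgebra.coeff_mul_single_of_forall_mul_ne r y fun w h => by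
    have := congrArg FreeMonoid.length h
    simp at this

lemma wordCoeff_mul_letter_concat (x z : CD) (r : k) (y : MonoidAlgebra k (FreeMonoid CD))
    (l : List CD) :
    wordCoeff (y * .single (.of x) r) (l ++ [z]) = if z = x then wordCoeff y l * r else 0 := by
  split_ifs with h
  · subst h
    exact MonoidAlgebra.coeff_mul_single_eq_coeff_mul _ fun w _ =>
      ⟨fun h => List.append_cancel_right (bs := [z]) h, fun h => by rw [h]; rfl⟩
  · refine MonoidAlgebra.coeff_mul_single_of_forall_mul_ne r y fun w hw => h ?_
    have h' : w.toList ++ [x] = l ++ [z] := hw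
    simpa using (congrArg List.getLast? h').symm

lemma wordCoeff_c_mul (y : MonoidAlgebra k (FreeMonoid CD)) (l : List CD) :
    wordCoeff (.single (.of CD.c) 1 * y) l = headC (wordCoeff y) l := by
  rcases l with _ | ⟨_ | _, l⟩ <;> simp [wordCoeff_letter_mul_nil, wordCoeff_letter_mul_cons]

lemma wordCoeff_mul_c (y : MonoidAlgebra k (FreeMonoid CD)) (l : List CD) :
    wordCoeff (y * .single (.of CD.c) 1) l = lastC (wordCoeff y) l := by
  induction l using list_concat_cases <;>
    simp [wordCoeff_mul_letter_nil, wordCoeff_mul_letter_concat]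

lemma wordCoeff_mul_d_mul (x y : MonoidAlgebra k (FreeMonoid CD)) (l : List CD) :
    wordCoeff (x * .single (.of CD.d) 1 * y) l
      = splitD (fun u v => wordCoeff x u * wordCoeff y v) l := by
  induction x using MonoidAlgebra.induction_linear with
  | zero => simp [splitD_zero]
  | add x x' hx hx' => simp only [add_mul, wordCoeff_add, hx, hx', splitD_add]
  | single w r =>
    rw [MonoidAlgebra.single_mul_single, mul_one]
    induction w using FreeMonoid.inductionOn' generalizing l with
    | one =>
      have h : ∀ u, wordCoeff (.single 1 r) u = if u = [] then r else 0 := fun u => by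
        have : (.single 1 r : MonoidAlgebra k (FreeMonoid CD)) = r • 1 := by
          simp [MonoidAlgebra.one_def]
        rw [this, wordCoeff_smul, wordCoeff_one]
        simp
      rcases l with _ | ⟨_ | _, l⟩ <;>
        simp [wordCoeff_letter_mul_nil, wordCoeff_letter_mul_cons, splitD, h, splitD_zero]
    | of_mul z w ih =>
      have h : ∀ w', (.single (FreeMonoid.of z * w') r : MonoidAlgebra k (FreeMonoid CD))
          = .single (.of z) 1 * .single w' r := fun w' => by
        rw [MonoidAlgebra.single_mul_single, one_mul]
      rw [mul_assoc, h, h, mul_assoc]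
      rcases l with _ | ⟨_ | _, l⟩
      · simp [wordCoeff_letter_mul_nil, splitD]
      · rw [wordCoeff_letter_mul_cons, ih, splitD]
        simp only [wordCoeff_letter_mul_cons]
        split_ifs
        · simp
        · simp [splitD_zero]
      · rw [wordCoeff_letter_mul_cons, ih, splitD, wordCoeff_letter_mul_nil]
        simp only [wordCoeff_letter_mul_cons]
        split_ifs
        · simp
        · simp [splitD_zero]

variable (k)

/-- The homogeneous components of the solution of the Riccati equation in `k⟨c, d⟩`. -/
noncomputable def cdRiccati (n : ℕ) : MonoidAlgebra k (FreeMonoid CD) :=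
  riccati k (.single (.of CD.c) 1) (.single (.of CD.d) 1) n

variable [CharZero k]

lemma wordCoeff_cdRiccati_zero (l : List CD) : wordCoeff (cdRiccati k 0) l = 0 := by
  rw [cdRiccati, (isRiccati_riccati k _ _).zero, wordCoeff_zero]

lemma wordCoeff_cdRiccati_succ (n : ℕ) (l : List CD) :
    ((n + 1 : ℕ) : k) * wordCoeff (cdRiccati k (n + 1)) l
      = (if n = 0 ∧ l = [] then 1 else 0)
        + 2⁻¹ * (headC (wordCoeff (cdRiccati k n)) l + lastC (wordCoeff (cdRiccati k n)) l)
        + 2⁻¹ * splitD (fun u v => ∑ p ∈ Finset.HasAntidiagonal.antidiagonal n,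
          wordCoeff (cdRiccati k p.1) u * wordCoeff (cdRiccati k p.2) v) l := by
  have h := congrArg (fun x => wordCoeff x l) ((isRiccati_riccati k
    (.single (.of CD.c) 1) (.single (.of CD.d) 1 : MonoidAlgebra k (FreeMonoid CD))).succ n)
  simp only [wordCoeff_add, wordCoeff_smul, wordCoeff_sum, wordCoeff_c_mul, wordCoeff_mul_c,
    wordCoeff_mul_d_mul] at h
  rw [splitD_sum]
  refine h.trans ?_
  congr 2
  rw [ite_and]
  split_ifs with h0 hl <;> simp_all [wordCoeff_one]

/-- The Riccati equation is homogeneous when the coefficient of `x^n` is given degree `n - 1`. -/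
lemma wordCoeff_cdRiccati_eq_zero {n : ℕ} {l : List CD} (h : listDeg l + 1 ≠ n) :
    wordCoeff (cdRiccati k n) l = 0 := by
  induction n using Nat.strong_induction_on generalizing l with
  | _ n ih =>
    cases n with
    | zero => exact wordCoeff_cdRiccati_zero k l
    | succ n =>
      have h0 : ((n + 1 : ℕ) : k) ≠ 0 := by exact_mod_cast n.succ_ne_zero
      apply mul_left_cancel₀ h0
      rw [wordCoeff_cdRiccati_succ, mul_zero]
      have e1 : headC (wordCoeff (cdRiccati k n)) l = 0 := by
        rcases l with _ | ⟨_ | _, l⟩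
        · rfl
        · exact ih n (by omega) (by simp [letterDeg] at h; omega)
        · rfl
      have e2 : lastC (wordCoeff (cdRiccati k n)) l = 0 := by
        induction l using list_concat_cases with
        | nil => rfl
        | concat_c l =>
          rw [lastC_concat_c]
          exact ih n (by omega) (by simp [letterDeg] at h; omega)
        | concat_d l => exact lastC_concat_d _ _
      have e3 : splitD (fun u v => ∑ p ∈ Finset.HasAntidiagonal.antidiagonal n,
          wordCoeff (cdRiccati k p.1) u * wordCoeff (cdRiccati k p.2) v) l = 0 := by
        rw [← splitD_zero l]
        refine splitD_congr fun u v huv => Finset.sum_eq_zero fun p hp => ?_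
        have hp' := Finset.HasAntidiagonal.mem_antidiagonal.1 hp
        have hl : listDeg l = listDeg u + (2 + listDeg v) := by rw [← huv]; simp [letterDeg]
        by_cases hu : listDeg u + 1 = p.1
        · rw [ih p.2 (by omega) (l := v) (by omega), mul_zero]
        · rw [ih p.1 (by omega) hu, zero_mul]
      rw [e1, e2, e3, if_neg]
      · simp
      · rintro ⟨rfl, rfl⟩
        exact h rfl

/-- The normalized **cd**-coefficients `β(w) / (deg w + 1)!` of the Boolean lattices. -/
noncomputable def normBeta (l : List CD) : k := wordCoeff (cdRiccati k (listDeg l + 1)) l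

/-- By homogeneity only one term of the convolution sum survives for each factorization `u d v`. -/
lemma isRiccatiCoeff_normBeta : IsRiccatiCoeff (normBeta k) := by
  intro l
  rw [normBeta, wordCoeff_cdRiccati_succ]
  have e1 : headC (wordCoeff (cdRiccati k (listDeg l))) l = headC (normBeta k) l := by
    rcases l with _ | ⟨_ | _, l⟩
    · rfl
    · simp [normBeta, letterDeg, add_comm]
    · rfl
  have e2 : lastC (wordCoeff (cdRiccati k (listDeg l))) l = lastC (normBeta k) l := by
    induction l using list_concat_cases with
    | nil => rfl
    | concat_c l => simp [normBeta, letterDeg]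
    | concat_d l => simp
  have e3 : splitD (fun u v => ∑ p ∈ Finset.HasAntidiagonal.antidiagonal (listDeg l),
      wordCoeff (cdRiccati k p.1) u * wordCoeff (cdRiccati k p.2) v) l
      = splitD (fun u v => normBeta k u * normBeta k v) l := by
    refine splitD_congr fun u v huv => ?_
    have hl : listDeg l = listDeg u + (2 + listDeg v) := by rw [← huv]; simp [letterDeg]
    refine Finset.sum_eq_single (listDeg u + 1, listDeg v + 1) ?_ ?_
    · rintro ⟨i, j⟩ hp hne
      have hp' := Finset.HasAntidiagonal.mem_antidiagonal.1 hp
      simp only at hp' ⊢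
      by_cases hu : listDeg u + 1 = i
      · rw [wordCoeff_cdRiccati_eq_zero k (l := v), mul_zero]
        rintro rfl
        exact hne (by rw [hu])
      · rw [wordCoeff_cdRiccati_eq_zero k hu, zero_mul]
    · intro h
      exact absurd (Finset.HasAntidiagonal.mem_antidiagonal.2 (by dsimp; omega)) h
  rw [e1, e2, e3]
  congr 3
  simp [listDeg_eq_zero]

lemma betaMon_some (v : FreeMonoid CD) :
    betaMon k (some v) = ((listDeg v.toList + 1).factorial : k) * normBeta k v.toList := by
  have h : FreeAlgebra.equivMonoidAlgebraFreeMonoid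
      (riccati k (FreeAlgebra.ι k CD.c) (FreeAlgebra.ι k CD.d) (wordDeg v + 1))
      = cdRiccati k (wordDeg v + 1) := by
    have h1 := (isRiccati_riccati k (FreeAlgebra.ι k CD.c) (FreeAlgebra.ι k CD.d)).map
      (FreeAlgebra.equivMonoidAlgebraFreeMonoid (R := k) (X := CD)).toAlgHom
    have h2 : ∀ x : CD, (FreeAlgebra.equivMonoidAlgebraFreeMonoid (R := k) (X := CD)).toAlgHom
        (FreeAlgebra.ι k x) = .single (.of x) 1 := fun x => by
      simp [FreeAlgebra.equivMonoidAlgebraFreeMonoid]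
    rw [h2, h2] at h1
    exact congrFun (h1.unique (isRiccati_riccati k _ _)) _
  rw [betaMon, cdIndex_boolean, map_nsmul, h, ← Nat.cast_smul_eq_nsmul k,
    MonoidAlgebra.coeff_smul_apply, smul_eq_mul]
  rfl

end Coefficients

/-! ### Explicit form of the product `⊙` -/

section Dot

variable {k : Type*} [Field k]

instance : DecidableEq (FreeMonoid CD) := inferInstanceAs (DecidableEq (List CD))

lemma toDual_mon (u w : Mon) : toDual k (mon k u) (mon k w) = if w = u then 1 else 0 := by
  simp [toDual, mon, Finsupp.single_apply, eq_comm]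

variable (k) in
/-- The coefficient of `u ⊗ v` in a tensor. -/
noncomputable def tensorCoeff (u v : Mon) : Fhat k ⊗[k] Fhat k →ₗ[k] k :=
  TensorProduct.dualDistrib k (Fhat k) (Fhat k) (toDual k (mon k u) ⊗ₜ toDual k (mon k v))

lemma tensorCoeff_mon (u v a b : Mon) :
    tensorCoeff k u v (mon k a ⊗ₜ mon k b) = (if a = u then 1 else 0) * if b = v then 1 else 0 := by
  rw [tensorCoeff, TensorProduct.dualDistrib_apply, toDual_mon, toDual_mon]

lemma tensorCoeff_words (u v a b : List CD) :
    tensorCoeff k (some (.ofList u)) (some (.ofList v))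
        (mon k (some (.ofList a)) ⊗ₜ mon k (some (.ofList b)))
      = (if u = a then 1 else 0) * if v = b then 1 else 0 := by
  rw [tensorCoeff_mon]
  congr 1 <;> exact if_congr (by rw [Option.some_inj, eq_comm]; rfl) rfl rfl

lemma toDual_concat_letter_cons (x y : CD) (u : List CD) (t : Fhat k) :
    toDual k (mon k (some (.ofList (y :: u)))) (concat k (mon k (some (.of x))) t)
      = if y = x then toDual k (mon k (some (.ofList u))) t else 0 := by
  induction t using Finsupp.induction_linear with
  | zero => simp
  | add s t hs ht =>
    rw [map_add, map_add, map_add, hs, ht]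
    split_ifs <;> simp
  | single w r =>
    have hr : (Finsupp.single w r : Fhat k) = r • mon k w := by simp [mon]
    rw [hr, map_smul, map_smul, map_smul, concat_mon]
    rcases w with _ | w
    · simp [concatMon, toDual_mon]
    · rw [concatMon, toDual_mon, toDual_mon]
      have h1 : (some (.of x * w) = some (.ofList (y :: u)) : Prop) ↔
          y = x ∧ (some w : Mon) = some (.ofList u) := by
        rw [Option.some_inj, Option.some_inj, FreeMonoid.ofList_cons]
        constructor
        · intro h
          have h' : x :: w.toList = y :: u := congrArg FreeMonoid.toList h
          exact ⟨(List.cons.inj h').1.symm, (List.cons.inj h').2⟩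
        · rintro ⟨rfl, rfl⟩
          rfl
      rw [if_congr h1 rfl rfl, ite_and, smul_ite, smul_zero]

lemma toDual_concat_letter_nil (x : CD) (t : Fhat k) :
    toDual k (mon k (some 1)) (concat k (mon k (some (.of x))) t) = 0 := by
  induction t using Finsupp.induction_linear with
  | zero => simp
  | add s t hs ht => rw [map_add, map_add, hs, ht, add_zero]
  | single w r =>
    have hr : (Finsupp.single w r : Fhat k) = r • mon k w := by simp [mon]
    rw [hr, map_smul, map_smul, concat_mon]
    rcases w with _ | w
    · simp [concatMon]
    · rw [concatMon, toDual_mon, if_neg, smul_zero]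
      intro h
      exact List.cons_ne_nil _ _ (Option.some_inj.1 h)

lemma toDual_none_concat (s t : Fhat k) : toDual k (mon k none) (concat k s t) = 0 := by
  induction s using Finsupp.induction_linear with
  | zero => simp
  | add s s' hs hs' => rw [map_add, LinearMap.add_apply, map_add, hs, hs', add_zero]
  | single v q =>
    induction t using Finsupp.induction_linear with
    | zero => simp
    | add s t hs ht => rw [map_add, map_add, hs, ht, add_zero]
    | single w r =>
      have hr : ∀ w r, (Finsupp.single w r : Fhat k) = r • mon k w := by simp [mon]
      rw [hr, hr, map_smul, LinearMap.map_smul₂, concat_mon]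
      rcases v with _ | v <;> rcases w with _ | w <;> simp [concatMon, toDual_mon]

lemma tensorCoeff_rTensor_cons (x y : CD) (u : List CD) (v : Mon) (t : Fhat k ⊗[k] Fhat k) :
    tensorCoeff k (some (.ofList (y :: u))) v
        ((concat k (mon k (some (.of x)))).rTensor (Fhat k) t)
      = if y = x then tensorCoeff k (some (.ofList u)) v t else 0 := by
  induction t using TensorProduct.induction_on with
  | zero => simp
  | add s t hs ht =>
    rw [map_add, map_add, map_add, hs, ht]
    split_ifs <;> simp
  | tmul s t =>
    rw [LinearMap.rTensor_tmul, tensorCoeff, tensorCoeff, TensorProduct.dualDistrib_apply,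
      TensorProduct.dualDistrib_apply, toDual_concat_letter_cons, ite_mul, zero_mul]

lemma tensorCoeff_rTensor_nil (x : CD) (v : Mon) (t : Fhat k ⊗[k] Fhat k) :
    tensorCoeff k (some 1) v ((concat k (mon k (some (.of x)))).rTensor (Fhat k) t) = 0 := by
  induction t using TensorProduct.induction_on with
  | zero => simp
  | add s t hs ht => rw [map_add, map_add, hs, ht, add_zero]
  | tmul s t =>
    rw [LinearMap.rTensor_tmul, tensorCoeff, TensorProduct.dualDistrib_apply,
      toDual_concat_letter_nil, zero_mul]

lemma tensorCoeff_rTensor_none (r : Fhat k) (v : Mon) (t : Fhat k ⊗[k] Fhat k) :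
    tensorCoeff k none v ((concat k r).rTensor (Fhat k) t) = 0 := by
  induction t using TensorProduct.induction_on with
  | zero => simp
  | add s t hs ht => rw [map_add, map_add, hs, ht, add_zero]
  | tmul s t =>
    rw [LinearMap.rTensor_tmul, tensorCoeff, TensorProduct.dualDistrib_apply,
      toDual_none_concat, zero_mul]

lemma tensorCoeff_lTensor_none (r : Fhat k) (u : Mon) (t : Fhat k ⊗[k] Fhat k) :
    tensorCoeff k u none (((concat k).flip r).lTensor (Fhat k) t) = 0 := by
  induction t using TensorProduct.induction_on with
  | zero => simp
  | add s t hs ht => rw [map_add, map_add, hs, ht, add_zero]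
  | tmul s t =>
    rw [LinearMap.lTensor_tmul, tensorCoeff, TensorProduct.dualDistrib_apply, LinearMap.flip_apply,
      toDual_none_concat, mul_zero]

lemma lTensor_copLetter (x : CD) (l : List CD) :
    ((concat k).flip (mon k (some (FreeMonoid.ofList l)))).lTensor (Fhat k) (copLetter k x)
      = match x with
        | CD.c => (2 : k) • (mon k (some 1) ⊗ₜ mon k (some (.ofList l)))
        | CD.d => mon k (some 1) ⊗ₜ mon k (some (.ofList (CD.c :: l)))
            + mon k (some (.of CD.c)) ⊗ₜ mon k (some (.ofList l)) := by
  cases x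
  · simp [copLetter, concat_mon, concatMon]
  · simp [copLetter, concat_mon, concatMon, cHat]

lemma tensorCoeff_none_copWord (v : Mon) (l : List CD) :
    tensorCoeff k none v (copWord k l) = 0 := by
  cases l with
  | nil => simp [copWord]
  | cons x l =>
    rw [copWord, map_add, tensorCoeff_rTensor_none, lTensor_copLetter]
    cases x <;> simp [tensorCoeff_mon]

lemma tensorCoeff_copWord_none (u : Mon) (l : List CD) :
    tensorCoeff k u none (copWord k l) = 0 := by
  induction l generalizing u with
  | nil => simp [copWord]
  | cons x l ih =>
    rw [copWord, map_add, tensorCoeff_lTensor_none, zero_add]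
    rcases u with _ | u
    · exact tensorCoeff_rTensor_none _ _ _
    · induction u using FreeMonoid.casesOn with
      | one => exact tensorCoeff_rTensor_nil _ _ _
      | of_mul y u =>
        refine (tensorCoeff_rTensor_cons x y u.toList none _).trans ?_
        rw [ih, ite_self]

lemma tensorCoeff_lTensor_copLetter (u v : List CD) (x : CD) (l : List CD) :
    tensorCoeff k (some (.ofList u)) (some (.ofList v))
        (((concat k).flip (mon k (some (FreeMonoid.ofList l)))).lTensor (Fhat k) (copLetter k x))
      = match x with
        | CD.c => 2 * ((if u = [] then 1 else 0) * if v = l then 1 else 0)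
        | CD.d => ((if u = [] then 1 else 0) * if v = CD.c :: l then 1 else 0)
            + (if u = [CD.c] then 1 else 0) * if v = l then 1 else 0 := by
  rw [lTensor_copLetter]
  have h1 : (1 : FreeMonoid CD) = .ofList [] := rfl
  have h2 : FreeMonoid.of CD.c = .ofList [CD.c] := rfl
  rw [h1, h2]
  cases x
  · simp only [map_smul, tensorCoeff_words, smul_eq_mul]
  · simp only [map_add, tensorCoeff_words]

/-- `Δ` cuts `l` at one letter: a `c` is removed with weight 2, a `d` leaves a `c` on one side.
Hence `u ⊗ v` arises only from `ucv`, from `udv'` with `v = cv'`, and from `u'dv` with `u = u'c`.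
The induction compares first letters. -/
lemma tensorCoeff_copWord (u v l : List CD) :
    tensorCoeff k (some (.ofList u)) (some (.ofList v)) (copWord k l)
      = dotEval (fun m => if m = l then 1 else 0) u v := by
  induction l generalizing u with
  | nil => simp [copWord, dotEval]
  | cons x l ih =>
    rw [copWord, map_add, tensorCoeff_lTensor_copLetter]
    rcases u with _ | ⟨y, u⟩
    · rw [FreeMonoid.ofList_nil, tensorCoeff_rTensor_nil]
      cases x <;> rcases v with _ | ⟨_ | _, v⟩ <;> simp [dotEval]
    · rw [tensorCoeff_rTensor_cons, ih]
      induction u using list_concat_cases <;> cases x <;> cases y <;>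
        rcases v with _ | ⟨_ | _, v⟩ <;> simp [dotEval]

variable (k) in
/-- The convolution product of two words. -/
noncomputable def dotWord (u v : List CD) : Fhat k :=
  (2 : k) • mon k (some (.ofList (u ++ CD.c :: v)))
    + headC (fun v' => mon k (some (.ofList (u ++ CD.d :: v')))) v
    + lastC (fun u' => mon k (some (.ofList (u' ++ CD.d :: v)))) u

lemma map_dotWord (φ : Fhat k →ₗ[k] k) (u v : List CD) :
    φ (dotWord k u v) = dotEval (fun l => φ (mon k (some (.ofList l)))) u v := by
  rw [dotWord, dotEval, map_add, map_add, map_smul, headC_apply φ (map_zero φ),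
    lastC_apply φ (map_zero φ), smul_eq_mul]

lemma mon_dot_mon_apply (u v w : Mon) :
    (mon k u ⊙ mon k v) w = tensorCoeff k u v (copMon k w) := by
  have hc : cop k (mon k w) = copMon k w := by simp [cop, mon]
  rw [← hc]
  rfl

lemma mon_some_dot_mon_some (u v : List CD) :
    mon k (some (.ofList u)) ⊙ mon k (some (.ofList v)) = dotWord k u v := by
  ext w
  rw [mon_dot_mon_apply]
  have h := map_dotWord (Finsupp.lapply w : Fhat k →ₗ[k] k) u v
  simp only [Finsupp.lapply_apply] at h
  rw [h]
  rcases w with _ | w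
  · rw [copMon, tensorCoeff_mon]
    simp [mon, dotEval]
  · rw [copMon, map_add, map_add, tensorCoeff_mon, tensorCoeff_mon, tensorCoeff_copWord]
    simp only [mon, Finsupp.single_apply, reduceCtorEq, if_false, zero_mul, mul_zero, add_zero]
    congr 1
    funext m
    refine if_congr ?_ rfl rfl
    rw [Option.some_inj]
    exact Iff.rfl

lemma mon_none_dot (v : Mon) : mon k none ⊙ mon k v = mon k v := by
  ext w
  rw [mon_dot_mon_apply]
  rcases w with _ | w
  · rw [copMon, tensorCoeff_mon]
    simp [mon, Finsupp.single_apply, eq_comm]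
  · rw [copMon, map_add, map_add, tensorCoeff_none_copWord, tensorCoeff_mon, tensorCoeff_mon]
    simp [mon, Finsupp.single_apply, eq_comm]

lemma mon_dot_none (u : Mon) : mon k u ⊙ mon k none = mon k u := by
  ext w
  rw [mon_dot_mon_apply]
  rcases w with _ | w
  · rw [copMon, tensorCoeff_mon]
    simp [mon, Finsupp.single_apply, eq_comm]
  · rw [copMon, map_add, map_add, tensorCoeff_copWord_none, tensorCoeff_mon, tensorCoeff_mon]
    simp [mon, Finsupp.single_apply, eq_comm]

end Dot

/-! ### `β` on products -/

section Beta

variable (k : Type*) [Field k]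

lemma beta_mon (v : Mon) : beta k (mon k v) = betaMon k v := by simp [beta, mon]

lemma degSucc_rev (v : Mon) : degSucc v.rev = degSucc v := by
  rcases v with _ | v
  · rfl
  · exact congrArg (· + 1) (listDeg_reverse v.toList)

/-- The normalized value `β(v) / (deg v + 1)!` at a monomial. -/
noncomputable def normBetaMon : Mon → k
  | none => 1
  | some v => normBeta k v.toList

variable [CharZero k]

lemma betaMon_eq (v : Mon) : betaMon k v = ((degSucc v).factorial : k) * normBetaMon k v := by
  rcases v with _ | v
  · simp [betaMon, normBetaMon, degSucc]
  · exact betaMon_some k v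

lemma normBetaMon_rev (v : Mon) : normBetaMon k v.rev = normBetaMon k v := by
  rcases v with _ | v
  · rfl
  · exact (isRiccatiCoeff_normBeta k).reverse v.toList

/-- Up to factorials, `β` is multiplicative for the product `⊙`. -/
lemma beta_mon_dot_mon (u v : Mon) : beta k (mon k u ⊙ mon k v)
    = ((degSucc u + degSucc v).factorial : k) * (normBetaMon k u * normBetaMon k v) := by
  rcases u with _ | u
  · rw [mon_none_dot, beta_mon, betaMon_eq]
    simp [degSucc, normBetaMon]
  rcases v with _ | v
  · rw [mon_dot_none, beta_mon, betaMon_eq]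
    simp [degSucc, normBetaMon]
  have h := mon_some_dot_mon_some (k := k) u.toList v.toList
  rw [FreeMonoid.ofList_toList, FreeMonoid.ofList_toList] at h
  rw [h, map_dotWord]
  simp only [beta_mon, betaMon_some, FreeMonoid.toList_ofList]
  rw [dotEval_listDeg_mul fun n => ((n + 1).factorial : k),
    (isRiccatiCoeff_normBeta k).dotEval_eq]
  congr 3
  change listDeg _ + listDeg _ + 1 + 1 = listDeg _ + 1 + (listDeg _ + 1)
  omega

/-- The product of `ud` and `dv` consists of `2 udcdv` alone, as there is no `c` at the junction to
turn into `d`. -/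
lemma normBeta_dcd (u v : List CD) : 2 * normBeta k (u ++ CD.d :: CD.c :: CD.d :: v)
    = normBeta k (u ++ [CD.d]) * normBeta k (CD.d :: v) := by
  rw [← (isRiccatiCoeff_normBeta k).dotEval_eq]
  simp [dotEval]

end Beta

/-! ### The reversal identities for words containing `dcd` -/

section Concatenation

variable (k : Type*) [Field k]

lemma mon_some_cat (u v : FreeMonoid CD) :
    mon k (some u) ⋄ mon k (some v) = mon k (some (u * v)) := concat_mon k _ _

lemma zero_cat (x : Fhat k) : (0 : Fhat k) ⋄ x = 0 := by simp [cat]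

lemma cat_mon_none (x : Fhat k) : x ⋄ mon k none = 0 := by
  induction x using Finsupp.induction_linear with
  | zero => exact zero_cat k _
  | add x y hx hy =>
    rw [cat] at *
    rw [map_add, LinearMap.add_apply, hx, hy, add_zero]
  | single w r =>
    have hr : (Finsupp.single w r : Fhat k) = r • mon k w := by simp [mon]
    rw [cat, hr, LinearMap.map_smul₂, concat_mon]
    rcases w with _ | w <;> simp [concatMon]

lemma mon_none_cat_mon (v : Mon) : mon k none ⋄ mon k v = 0 := by
  rw [cat, concat_mon, concatMon]
  simp

variable [CharZero k]

lemma beta_d_rev_dcd (u v : Mon) :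
    beta k (dHat k ⋄ mon k u ⋄ dHat k ⋄ cHat k ⋄ dHat k ⋄ mon k v) =
      beta k (dHat k ⋄ mon k u.rev ⋄ dHat k ⋄ cHat k ⋄ dHat k ⋄ mon k v) := by
  rcases u with _ | u
  · rfl
  rcases v with _ | v
  · rw [cat_mon_none, cat_mon_none]
  -- The letters `d, d, c, d` have total degree 7, hence the 8 in the factorial. The dependence on
  -- `u` is through its degree and `g(dud)`, both invariant under reversal.
  have key : ∀ u : FreeMonoid CD,
      2 * beta k (dHat k ⋄ mon k (some u) ⋄ dHat k ⋄ cHat k ⋄ dHat k ⋄ mon k (some v))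
      = ((listDeg u.toList + listDeg v.toList + 8).factorial : k)
        * (normBeta k (CD.d :: (u.toList ++ [CD.d])) * normBeta k (CD.d :: v.toList)) := by
    intro u
    have h := normBeta_dcd k (CD.d :: u.toList) v.toList
    rw [List.cons_append, List.cons_append] at h
    rw [← h]
    simp only [dHat, cHat, mon_some_cat, beta_mon, betaMon_some, FreeMonoid.toList_mul,
      FreeMonoid.toList_of, List.append_assoc, List.cons_append, List.nil_append, listDeg_cons,
      listDeg_append, letterDeg]
    ring_nf
  apply mul_left_cancel₀ (two_ne_zero (α := k))
  have h := (isRiccatiCoeff_normBeta k).reverse (CD.d :: (u.toList ++ [CD.d]))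
  simp only [List.reverse_cons, List.reverse_append, List.reverse_nil, List.nil_append,
    List.cons_append] at h
  have hrev : Mon.rev (some u) = some u.reverse := rfl
  have hl : u.reverse.toList = u.toList.reverse := rfl
  rw [hrev, key, key, hl, h, listDeg_reverse]

lemma beta_dcd_rev_dcd (u v w : Mon) :
    beta k (mon k u ⋄ dHat k ⋄ cHat k ⋄ dHat k ⋄ mon k v ⋄ dHat k ⋄ cHat k ⋄ dHat k ⋄ mon k w) =
      beta k (mon k u ⋄ dHat k ⋄ cHat k ⋄ dHat k ⋄ mon k v.rev ⋄
        dHat k ⋄ cHat k ⋄ dHat k ⋄ mon k w) := by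
  rcases v with _ | v
  · rfl
  rcases w with _ | w
  · rw [cat_mon_none, cat_mon_none]
  rcases u with _ | u
  · have h : mon k none ⋄ dHat k = 0 := mon_none_cat_mon k _
    simp only [h, zero_cat]
  have key : ∀ v : FreeMonoid CD,
      2 * (2 * beta k (mon k (some u) ⋄ dHat k ⋄ cHat k ⋄ dHat k ⋄ mon k (some v) ⋄ dHat k ⋄
        cHat k ⋄ dHat k ⋄ mon k (some w)))
      = ((listDeg u.toList + listDeg v.toList + listDeg w.toList + 11).factorial : k)
        * (normBeta k (u.toList ++ [CD.d]) * normBeta k (CD.d :: (v.toList ++ [CD.d]))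
          * normBeta k (CD.d :: w.toList)) := by
    intro v
    -- Cutting at the second `dcd` splits off `dw`; cutting the remaining `udcdvd` at its first
    -- `dcd` isolates `dvd`.
    have h1 := normBeta_dcd k (u.toList ++ CD.d :: CD.c :: CD.d :: v.toList) w.toList
    have h2 := normBeta_dcd k u.toList (v.toList ++ [CD.d])
    rw [← h2, mul_assoc, ← List.cons_append, ← List.cons_append, ← List.cons_append,
      ← List.append_assoc, ← h1]
    simp only [dHat, cHat, mon_some_cat, beta_mon, betaMon_some, FreeMonoid.toList_mul,
      FreeMonoid.toList_of, List.append_assoc, List.cons_append, List.nil_append, listDeg_cons,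
      listDeg_append, letterDeg]
    ring_nf
  apply mul_left_cancel₀ (two_ne_zero (α := k))
  apply mul_left_cancel₀ (two_ne_zero (α := k))
  have h := (isRiccatiCoeff_normBeta k).reverse (CD.d :: (v.toList ++ [CD.d]))
  simp only [List.reverse_cons, List.reverse_append, List.reverse_nil, List.nil_append,
    List.cons_append] at h
  have hrev : Mon.rev (some v) = some v.reverse := rfl
  have hl : v.reverse.toList = v.toList.reverse := rfl
  rw [hrev, key, key, hl, h, listDeg_reverse]

end Concatenation

end CDIndex

open CDIndex in
theorem lemmal (k : Type*) [Field k] [CharZero k] :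
    (∀ n : ℕ, ∃! Φ : FreeAlgebra k CD, cdToAB k Φ = abIndex (Boolean (n + 1)) k) ∧
    (∀ u v : Mon,
      beta k (mon k u ⊙ mon k v) = beta k (mon k u ⊙ mon k v.rev) ∧
      beta k (mon k u ⊙ mon k v.rev) = beta k (mon k u.rev ⊙ mon k v) ∧
      beta k (mon k u ⊙ mon k v) = beta k (mon k v ⊙ mon k u)) ∧
    (∀ u v : Mon,
      beta k (dHat k ⋄ mon k u ⋄ dHat k ⋄ cHat k ⋄ dHat k ⋄ mon k v) =
        beta k (dHat k ⋄ mon k u.rev ⋄ dHat k ⋄ cHat k ⋄ dHat k ⋄ mon k v)) ∧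
    (∀ u v w : Mon,
      beta k (mon k u ⋄ dHat k ⋄ cHat k ⋄ dHat k ⋄ mon k v ⋄ dHat k ⋄ cHat k ⋄ dHat k ⋄ mon k w) =
        beta k (mon k u ⋄ dHat k ⋄ cHat k ⋄ dHat k ⋄ mon k v.rev ⋄
          dHat k ⋄ cHat k ⋄ dHat k ⋄ mon k w)) := by
  refine ⟨existsUnique_cdToAB_boolean k, fun u v => ⟨?_, ?_, ?_⟩, beta_d_rev_dcd k,
    beta_dcd_rev_dcd k⟩
  · rw [beta_mon_dot_mon, beta_mon_dot_mon, degSucc_rev, normBetaMon_rev]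
  · rw [beta_mon_dot_mon, beta_mon_dot_mon, degSucc_rev, degSucc_rev, normBetaMon_rev,
      normBetaMon_rev]
  · rw [beta_mon_dot_mon, beta_mon_dot_mon, add_comm, mul_comm (normBetaMon k u)]
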